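/- Let $\Delta\subset\mathbb{R}^n$ be a Delzant reflexive polytope of dimension $n$. Here *Delzant* means that exactly $n$ edges meet at each vertex $v$, and that they are of the form $v+tw_i$, $t\ge 0$, with $w_i\in\mathbb{Z}^n$ that can be chosen so that $w_1,\dots,w_n$ is a basis of $\mathbb{Z}^n$. *Reflexive* means that the vertices of $\Delta$ are in $\mathbb{Z}^n$, that $\mathbf 0$ is in the interior of $\Delta$, and that $\Delta=\bigcap_i\{x\mid\langle x,l_i\rangle\le 1\}$, where the $l_i\in\mathbb{Z}^n$ are the primitive outward normal vectors to the facets of $\Delta$. Let $\Delta[1]$ be the set of edges of $\Delta$, and for an edge $e$ from $v_1$ to $v_2$ let $l(e)>0$ be its relative length, defined by $v_2-v_1=l(e)\,w$ with $w\in\mathbb{Z}^n$ primitive. Let $$k_0=\gcd\{l(e)\mid e\in\Delta[1]\}$$ be the index of $\Delta$ (with $k_0=0$ if $n=0$). Let $f_i$ be the number of $i$-dimensional faces of $\Delta$ (so $f_n=1$, and $f_i=0$ for $i>n$) and, for $0\le j\le n$, $$h_j=\sum_{i=0}^{j}(-1)^{j-i}\binom{n-i}{n-j}f_{n-i}.$$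 Put $C(k_0,n,\mathbf f)=12f_2+(5-3n-k_0)f_1$, and define $C(k_0,n,\mathbf h)$ for $n=2m$ even as $$\sum_{k=1}^{m}\big[12k^2-2m(k_0+1)\big]h_{m-k}-m(k_0+1)h_m$$ and for $n=2m+1$ odd as $$\sum_{k=1}^{m}\big[12k(k+1)+3-(2m+1)(k_0+1)\big]h_{m-k}-\big[(2m+1)(k_0+1)-3\big]h_m.$$ Then $C(k_0,n,\mathbf f)=C(k_0,n,\mathbf h)$, and this integer is a non-negative multiple of $k_0$. Moreover, it is zero if and only if $l(e)=k_0$ for all $e\in\Delta[1]$. -/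

import Mathlib

open scoped BigOperators

namespace DelzantReflexive

/-- An integral vector of `ℤ^n`, viewed in `ℝ^n`. -/
def toReal {n : ℕ} (w : Fin n → ℤ) : Fin n → ℝ := fun i => (w i : ℝ)

/-- `w` is primitive in the lattice `ℤ^n`: it is an integral multiple `m • u` of an integral
vector `u` only for `m = ± 1`. (In particular `w ≠ 0`.) -/
def IsPrimitive {n : ℕ} (w : Fin n → ℤ) : Prop :=
  ∀ (m : ℤ) (u : Fin n → ℤ), w = m • u → m = 1 ∨ m = -1

/-- A (convex) polytope in `ℝ^n`: the convex hull of a finite set of points. -/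
def IsPolytope {n : ℕ} (P : Set (Fin n → ℝ)) : Prop :=
  ∃ S : Finset (Fin n → ℝ), P = convexHull ℝ (S : Set (Fin n → ℝ))

/-- The dimension of a nonempty convex set is the dimension of its affine span. -/
noncomputable def dim {n : ℕ} (F : Set (Fin n → ℝ)) : ℕ :=
  Module.finrank ℝ (affineSpan ℝ F).direction

/-- The set `Δ[i]` of `i`-dimensional faces of `P`. A face is a nonempty set of the form
`{x ∈ P | a linear functional attains its maximum over P at x}`; the functional `0` is allowed, so
`P` is a face of itself. -/
def faces {n : ℕ} (P : Set (Fin n → ℝ)) (i : ℕ) : Set (Set (Fin n → ℝ)) :=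
  {F | IsExposed ℝ P F ∧ F.Nonempty ∧ dim F = i}

/-- The vertices of `P`, as points. -/
def vertices {n : ℕ} (P : Set (Fin n → ℝ)) : Set (Fin n → ℝ) :=
  {v | {v} ∈ faces P 0}

/-- The edges of `P` meeting at `v`. -/
def edgesAt {n : ℕ} (P : Set (Fin n → ℝ)) (v : Fin n → ℝ) : Set (Set (Fin n → ℝ)) :=
  {e | e ∈ faces P 1 ∧ v ∈ e}

/-- The edge `e` starting at `v` is of the form `v + t w`, `t ≥ 0`. -/
def PointsAlong {n : ℕ} (e : Set (Fin n → ℝ)) (v : Fin n → ℝ) (w : Fin n → ℤ) : Prop :=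
  ∀ x ∈ e, ∃ t : ℝ, 0 ≤ t ∧ x = v + t • toReal w

/-- (D1) `P` is simple: exactly `n` edges meet at each vertex. -/
def IsSimplePolytope {n : ℕ} (P : Set (Fin n → ℝ)) : Prop :=
  ∀ v ∈ vertices P, (edgesAt P v).ncard = n

/-- (D2) `P` is rational: the edges at each vertex point along integral vectors. -/
def IsRational {n : ℕ} (P : Set (Fin n → ℝ)) : Prop :=
  ∀ v ∈ vertices P, ∀ e ∈ edgesAt P v, ∃ w : Fin n → ℤ, PointsAlong e v w

/-- (D3) `P` is smooth: at each vertex the integral vectors along which the edges point can be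
chosen to form a basis of `ℤ^n`. -/
def IsSmooth {n : ℕ} (P : Set (Fin n → ℝ)) : Prop :=
  ∀ v ∈ vertices P, ∃ b : Module.Basis (edgesAt P v) ℤ (Fin n → ℤ),
    ∀ e : edgesAt P v, PointsAlong e.1 v (b e)

/-- A Delzant polytope in `ℝ^n` (full-dimensional, simple, rational and smooth). -/
structure IsDelzant {n : ℕ} (P : Set (Fin n → ℝ)) : Prop where
  polytope : IsPolytope P
  fullDim : dim P = n
  simple : IsSimplePolytope P
  rational : IsRational P
  smooth : IsSmooth P

/-- The polytope `P` is integral: all its vertices are lattice points. -/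
def IsIntegral {n : ℕ} (P : Set (Fin n → ℝ)) : Prop :=
  ∀ v ∈ vertices P, ∃ u : Fin n → ℤ, v = toReal u

/-- The primitive outward normal vectors to the hyperplanes supporting the facets of `P`. -/
def facetNormals {n : ℕ} (P : Set (Fin n → ℝ)) : Set (Fin n → ℤ) :=
  {l | IsPrimitive l ∧ ∃ (m : ℝ) (d : ℕ), d + 1 = n ∧ (∀ x ∈ P, x ⬝ᵥ toReal l ≤ m) ∧
    {x ∈ P | x ⬝ᵥ toReal l = m} ∈ faces P d}

/-- A reflexive polytope: an integral polytope of dimension `n` in `ℝ^n` with `0` in its interior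
which is the intersection of the half spaces `⟨x, l⟩ ≤ 1`, where `l` runs over the primitive outward
normal vectors to the facets. -/
structure IsReflexive {n : ℕ} (P : Set (Fin n → ℝ)) : Prop where
  polytope : IsPolytope P
  integral : IsIntegral P
  zero_mem_interior : (0 : Fin n → ℝ) ∈ interior P
  eq_inter : P = ⋂ l ∈ facetNormals P, {x | x ⬝ᵥ toReal l ≤ 1}

/-- `r` is the relative length of the segment `e`: `e` goes from `v₁` to `v₂` with
`v₂ - v₁ = r • w` for some primitive `w ∈ ℤ^n` and `r > 0`. -/
def HasRelLength {n : ℕ} (e : Set (Fin n → ℝ)) (r : ℝ) : Prop :=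
  0 < r ∧ ∃ (v₁ v₂ : Fin n → ℝ) (w : Fin n → ℤ),
    e = segment ℝ v₁ v₂ ∧ IsPrimitive w ∧ v₂ - v₁ = r • toReal w

/-- The relative length `l(e)`: the number `r` with `HasRelLength e r` (it is unique, and it exists
for each edge of an integral polytope). -/
noncomputable def relLength {n : ℕ} (e : Set (Fin n → ℝ)) : ℝ :=
  Classical.epsilon (HasRelLength e)

/-- The index `k₀`: the greatest common divisor of the relative lengths of the edges, that is, the
largest natural number of which each of these lengths is an integral multiple. (If there are no
edges, which happens only for `n = 0`, this is `0`.) -/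
noncomputable def index {n : ℕ} (P : Set (Fin n → ℝ)) : ℕ :=
  sSup {k : ℕ | ∀ e ∈ faces P 1, ∃ q : ℕ, relLength e = (k : ℝ) * (q : ℝ)}

/-- The `f`-vector. -/
noncomputable def fVec {n : ℕ} (P : Set (Fin n → ℝ)) (i : ℕ) : ℕ := (faces P i).ncard

/-- The `h`-vector (for `j ≤ n`, so that no subtraction of natural numbers is truncated). -/
noncomputable def hVec {n : ℕ} (P : Set (Fin n → ℝ)) (j : ℕ) : ℤ :=
  ∑ i ∈ Finset.range (j + 1),
    (-1) ^ (j - i) * (Nat.choose (n - i) (n - j) : ℤ) * (fVec P (n - i) : ℤ)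

/-- `C(k₀, n, f)`. -/
def Cf (k₀ n : ℕ) (f : ℕ → ℕ) : ℤ :=
  12 * (f 2 : ℤ) + (5 - 3 * (n : ℤ) - (k₀ : ℤ)) * (f 1 : ℤ)

/-- `C(k₀, 2m, h)`. -/
def ChEven (k₀ m : ℕ) (h : ℕ → ℤ) : ℤ :=
  (∑ k ∈ Finset.Icc 1 m, (12 * (k : ℤ) ^ 2 - 2 * (m : ℤ) * ((k₀ : ℤ) + 1)) * h (m - k))
    - (m : ℤ) * ((k₀ : ℤ) + 1) * h m

/-- `C(k₀, 2m + 1, h)`. -/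
def ChOdd (k₀ m : ℕ) (h : ℕ → ℤ) : ℤ :=
  (∑ k ∈ Finset.Icc 1 m,
      (12 * (k : ℤ) * ((k : ℤ) + 1) + 3 - (2 * (m : ℤ) + 1) * ((k₀ : ℤ) + 1)) * h (m - k))
    - ((2 * (m : ℤ) + 1) * ((k₀ : ℤ) + 1) - 3) * h m

/-- `C(k₀, n, h)`. -/
def Ch (k₀ n : ℕ) (h : ℕ → ℤ) : ℤ :=
  if n % 2 = 0 then ChEven k₀ (n / 2) h else ChOdd k₀ (n / 2) h

end DelzantReflexive

/-! Everything reduces to Σ_e l(e) = 12 f₂ + (5 - 3n) f₁ (`sum_relLength`): then C(k₀, n, f) = Σ_e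
(l(e) - k₀) (`Cf_eq_sum`), and each summand is a nonnegative multiple of k₀.

Take an integral ξ that is nonconstant on every edge and put m_e = ⟨ξ, w_e⟩ for the edge vectors at
v. An edge from v to u has length (⟨ξ, u⟩ - ⟨ξ, v⟩)/m_e, and reversing edges turns the total into
-Σ_{v,e} ⟨ξ, v⟩/m_e. Reflexivity gives v = -Σ_f w_f (`dotProduct_dualVec_eq_neg_one`), so what
matters is Σ m_f/m_e over ordered pairs of distinct edges at a vertex.

By Dedekind reciprocity, m_f/m_e + m_e/m_f = 12 (s(m_f, m_e) + s(m_e, m_f)) - gcd²/(m_e m_f) + 3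
sign(m_e) sign(m_f). Passing along e to its other end negates m_e and changes m_f by a multiple of
m_e (`exists_transport`), so the Dedekind sums cancel in pairs. The gcd² terms cancel likewise,
after a splitting by a second functional. Only the signs survive
(`LatticeGraph.sum_ratio_eq_sum_sign`), and they depend only on the number d(v) of edges at v along
which ξ decreases.

Each face has a unique highest vertex and is spanned there by descending edges, so f_i = Σ_v C(d(v),
i) (`fVec_eq_sum`) and h_j counts the v with d(v) = n - j. Replacing ξ by -ξ makes h palindromic.
This evaluates the sign sum in terms of f₁ and f₂, and also yields the identity between the f- and
h-expressions. -/

namespace DelzantReflexive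

/-! ### Dedekind sums and their reciprocity law. -/

/-- The symmetric term of Dedekind reciprocity. -/
def recipTerm (h k : ℕ) : ℚ :=
  ((h : ℚ) / k + k / h + (Nat.gcd h k : ℚ) ^ 2 / (h * k)) / 12 - 1 / 4

lemma recipTerm_comm (h k : ℕ) : recipTerm h k = recipTerm k h := by
  unfold recipTerm
  rw [Nat.gcd_comm, mul_comm (h : ℚ)]
  ring

lemma recipTerm_self {h : ℕ} (hh : 0 < h) : recipTerm h h = 0 := by
  unfold recipTerm
  have : (h : ℚ) ≠ 0 := by positivity
  rw [Nat.gcd_self]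
  field_simp
  norm_num

/-- The Dedekind sum `s(h, k)` for natural numbers, computed by the Euclidean algorithm. -/
def dedekindNat (h k : ℕ) : ℚ :=
  if _hk : k = 0 ∨ h % k = 0 then 0
  else recipTerm (h % k) k - dedekindNat k (h % k)
termination_by k
decreasing_by exact Nat.mod_lt _ (by omega)

lemma dedekindNat_congr {h h' k : ℕ} (e : h % k = h' % k) :
    dedekindNat h k = dedekindNat h' k := by
  rw [dedekindNat.eq_def h k, dedekindNat.eq_def h' k, e]

lemma dedekindNat_of_dvd {h k : ℕ} (e : h % k = 0) : dedekindNat h k = 0 := by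
  rw [dedekindNat, dif_pos (Or.inr e)]

/-- For h < k the recursion defining `dedekindNat` is the reciprocity law itself; the real content
lies in oddness, `dedekindNat_sub`. -/
lemma dedekindNat_add_of_lt {h k : ℕ} (hh : 0 < h) (hk : h < k) :
    dedekindNat h k + dedekindNat k h = recipTerm h k := by
  rw [dedekindNat, dif_neg, Nat.mod_eq_of_lt hk]
  · ring
  · rw [Nat.mod_eq_of_lt hk]
    omega

lemma dedekindNat_add {h k : ℕ} (hh : 0 < h) (hk : 0 < k) :
    dedekindNat h k + dedekindNat k h = recipTerm h k := by
  rcases lt_trichotomy h k with hlt | rfl | hlt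
  · exact dedekindNat_add_of_lt hh hlt
  · rw [dedekindNat_of_dvd (Nat.mod_self h), recipTerm_self hh, add_zero]
  · rw [add_comm, recipTerm_comm]
    exact dedekindNat_add_of_lt hk hlt

/-- The three gcds agree, so their terms cancel by 1/(ab) = 1/(a(a+b)) + 1/(b(a+b)). The other
fractions add up to 3, and 3/12 offsets the constant 1/4. -/
lemma recipTerm_add {a b : ℕ} (ha : 0 < a) (hb : 0 < b) :
    recipTerm b (a + b) - recipTerm a b + recipTerm a (a + b) = 0 := by
  have ha' : (a : ℚ) ≠ 0 := by positivity
  have hb' : (b : ℚ) ≠ 0 := by positivity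
  have hab : (a : ℚ) + b ≠ 0 := by positivity
  have h1 : Nat.gcd b (a + b) = Nat.gcd a b := by simp [Nat.gcd_comm]
  have h2 : Nat.gcd a (a + b) = Nat.gcd a b := by simp
  unfold recipTerm
  rw [h1, h2]
  push_cast
  field_simp
  ring

/-- Write k = h + b and apply reciprocity to (b, k), (h, k) and (h, b). As k ≡ h mod b and k ≡ b mod
h, the sums with smaller modulus cancel, and `recipTerm_add` disposes of the rest. -/
lemma dedekindNat_sub {h k : ℕ} (hh : 0 < h) (hk : h < k) :
    dedekindNat (k - h) k = - dedekindNat h k := by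
  obtain ⟨b, rfl⟩ := Nat.exists_eq_add_of_lt hk
  set b' := b + 1 with hb'
  have e : h + b + 1 = h + b' := by omega
  have hb : 0 < b' := by omega
  rw [e, Nat.add_sub_cancel_left]
  have h1 := dedekindNat_add (h := b') (k := h + b') hb (by omega)
  have h2 := dedekindNat_add hh hb
  have h3 := dedekindNat_add (h := h) (k := h + b') hh (by omega)
  have h4 : dedekindNat (h + b') b' = dedekindNat h b' := dedekindNat_congr (by simp)
  have h5 : dedekindNat (h + b') h = dedekindNat b' h := dedekindNat_congr (by simp)
  have h6 := recipTerm_add hh hb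
  linarith

/-- The Dedekind sum for integers, made odd in both arguments. -/
def dedekind (h k : ℤ) : ℚ := (k.sign : ℚ) * dedekindNat (h % k).toNat k.natAbs

lemma dedekind_congr {h h' k a : ℤ} (e : h' = h - a * k) : dedekind h' k = dedekind h k := by
  unfold dedekind
  rw [e, Int.sub_mul_emod_self_right]

lemma dedekind_neg_right (h k : ℤ) : dedekind h (-k) = - dedekind h k := by
  simp [dedekind]

lemma dedekind_neg_left (h : ℤ) {k : ℤ} (hk : k ≠ 0) : dedekind (-h) k = - dedekind h k := by
  unfold dedekind
  by_cases h0 : h % k = 0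
  · have h1 : (-h) % k = 0 := Int.emod_eq_zero_of_dvd ((Int.dvd_neg).2 (Int.dvd_of_emod_eq_zero h0))
    rw [h0, h1]
    rw [Int.toNat_zero, dedekindNat_of_dvd (Nat.zero_mod _)]
    simp
  · have hpos := Int.emod_nonneg h hk
    have hlt := Int.emod_lt_abs h hk
    have h1 : (-h) % k = |k| - h % k := by
      have e : (-h) % k = (|k| - h % k) % k := by
        apply Int.ModEq.symm
        apply Int.modEq_of_dvd
        have h2 : k ∣ |k| := (dvd_abs k k).2 dvd_rfl
        have h3 : k ∣ h - h % k := Int.dvd_self_sub_emod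
        have h4 : -h - (|k| - h % k) = -(h - h % k) - |k| := by ring
        rw [h4]
        exact dvd_sub ((dvd_neg).2 h3) h2
      rw [e, ← Int.emod_abs]
      exact Int.emod_eq_of_lt (by omega) (by omega)
    have h2 : ((-h) % k).toNat = k.natAbs - (h % k).toNat := by
      have := Int.abs_eq_natAbs k
      omega
    rw [h2, dedekindNat_sub (by omega) (by have := Int.abs_eq_natAbs k; omega)]
    ring

lemma dedekind_natCast (h k : ℕ) (hk : 0 < k) : dedekind h k = dedekindNat h k := by
  unfold dedekind
  rw [Int.sign_eq_one_of_pos (by exact_mod_cast hk), ← Int.natCast_mod, Int.toNat_natCast,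
    Int.natAbs_natCast, Int.cast_one, one_mul]
  exact dedekindNat_congr (Nat.mod_mod _ _)

/-- Dedekind reciprocity. -/
lemma dedekind_add {h k : ℤ} (hh : h ≠ 0) (hk : k ≠ 0) :
    dedekind h k + dedekind k h =
      ((h : ℚ) / k + k / h + (Int.gcd h k : ℚ) ^ 2 / (h * k)) / 12
        - (h.sign : ℚ) * (k.sign : ℚ) / 4 := by
  -- Both sides are odd in h and in k, so the four sign patterns reduce to positive arguments.
  have key : ∀ a b : ℕ, 0 < a → 0 < b → dedekind a b + dedekind b a =
      ((a : ℚ) / b + b / a + (Nat.gcd a b : ℚ) ^ 2 / (a * b)) / 12 - 1 / 4 := by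
    intro a b ha hb
    rw [dedekind_natCast a b hb, dedekind_natCast b a ha, dedekindNat_add ha hb, recipTerm]
  obtain ⟨a, ha | ha⟩ := Int.eq_nat_or_neg h <;> obtain ⟨b, hb | hb⟩ := Int.eq_nat_or_neg k <;>
    subst ha <;> subst hb
  all_goals
    have ha : 0 < a := by omega
    have hb : 0 < b := by omega
    have ha' : (a : ℤ) ≠ 0 := by omega
    have hb' : (b : ℤ) ≠ 0 := by omega
    have ks := key a b ha hb
    have sa : (a : ℤ).sign = 1 := Int.sign_eq_one_of_pos (by omega)
    have sb : (b : ℤ).sign = 1 := Int.sign_eq_one_of_pos (by omega)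
  · rw [ks, sa, sb]
    simp
  · rw [dedekind_neg_right, dedekind_neg_left _ ha', Int.sign_neg, sa, sb, Int.gcd_neg,
      Int.gcd_natCast_natCast]
    push_cast
    linear_combination (-1 : ℚ) * ks
  · rw [dedekind_neg_right, dedekind_neg_left _ hb', Int.sign_neg, sa, sb, Int.neg_gcd,
      Int.gcd_natCast_natCast]
    push_cast
    linear_combination (-1 : ℚ) * ks
  · rw [dedekind_neg_right, dedekind_neg_left _ hb', dedekind_neg_right,
      dedekind_neg_left _ ha', Int.sign_neg, Int.sign_neg, sa, sb, Int.neg_gcd, Int.gcd_neg,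
      Int.gcd_natCast_natCast]
    push_cast
    linear_combination ks

end DelzantReflexive

/-! ### Abstract edge graphs and the cancellation of Dedekind sums. -/

namespace DelzantReflexive

/-- Finitely many nonzero integral vectors are avoided by the kernel of some integral functional. -/
lemma exists_generic {n : ℕ} (U : Finset (Fin n → ℤ)) (hU : ∀ u ∈ U, u ≠ 0) :
    ∃ ξ : Fin n → ℤ, ∀ u ∈ U, ξ ⬝ᵥ u ≠ 0 := by
  classical
  -- With ξ = (1, x, x², …) the pairing with u is the value at x of the polynomial with coefficients
  -- u; x is chosen off the roots of the product.
  let p : (Fin n → ℤ) → Polynomial ℤ := fun u =>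
    ∑ i : Fin n, Polynomial.C (u i) * Polynomial.X ^ (i : ℕ)
  have hp : ∀ u ∈ U, p u ≠ 0 := by
    intro u hu h0
    apply hU u hu
    funext i
    have := congrArg (fun q => Polynomial.coeff q (i : ℕ)) h0
    simpa [p, Polynomial.finsetSum_coeff, Polynomial.coeff_X_pow, Fin.val_inj] using this
  have hprod : ∏ u ∈ U, p u ≠ 0 := Finset.prod_ne_zero_iff.2 hp
  obtain ⟨x, hx⟩ : ∃ x, (∏ u ∈ U, p u).eval x ≠ 0 := by
    by_contra! h
    exact hprod (Polynomial.funext (by simpa using h))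
  refine ⟨fun i => x ^ (i : ℕ), fun u hu h0 => hx ?_⟩
  rw [Polynomial.eval_prod]
  refine Finset.prod_eq_zero hu ?_
  rw [← h0]
  simp [p, Polynomial.eval_finsetSum, dotProduct, mul_comm]

/-- The combinatorial data of the edge graph of a smooth polytope: at each vertex a family of
integral edge vectors with dual vectors; neighbouring families agree modulo the common edge. -/
structure LatticeGraph (n : ℕ) (α β : Type*) [DecidableEq β] where
  V : Finset α
  E : α → Finset β
  other : α → β → α
  W : α → β → Fin n → ℤ
  D : α → β → Fin n → ℤ
  other_mem : ∀ {v e}, v ∈ V → e ∈ E v → other v e ∈ V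
  mem_other : ∀ {v e}, v ∈ V → e ∈ E v → e ∈ E (other v e)
  other_other : ∀ {v e}, v ∈ V → e ∈ E v → other (other v e) e = v
  W_other : ∀ {v e}, v ∈ V → e ∈ E v → W (other v e) e = - W v e
  dual : ∀ {v e f}, v ∈ V → e ∈ E v → f ∈ E v → W v e ⬝ᵥ D v f = if e = f then 1 else 0
  exists_transport : ∀ {v e f}, v ∈ V → e ∈ E v → f ∈ E v → f ≠ e →
    ∃ g ∈ E (other v e), g ≠ e ∧ ∃ a : ℤ, W (other v e) g = W v f - a • W v e

namespace LatticeGraph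

variable {n : ℕ} {α β : Type*} [DecidableEq β] (Γ : LatticeGraph n α β)

/-- `g` corresponds to `f` under the passage along `e` from `v` to its neighbour. -/
def Transport (v : α) (e f g : β) : Prop :=
  g ∈ Γ.E (Γ.other v e) ∧ g ≠ e ∧ ∃ a : ℤ, Γ.W (Γ.other v e) g = Γ.W v f - a • Γ.W v e

variable {Γ}

lemma Transport.symm {v : α} {e f g : β} (hv : v ∈ Γ.V) (he : e ∈ Γ.E v) (hf : f ∈ Γ.E v)
    (hfe : f ≠ e) (h : Γ.Transport v e f g) : Γ.Transport (Γ.other v e) e g f := by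
  obtain ⟨_, _, a, ha⟩ := h
  rw [Transport, Γ.other_other hv he]
  refine ⟨hf, hfe, a, ?_⟩
  rw [ha, Γ.W_other hv he]
  simp

/-- Two candidates differ by a multiple of the common edge vector, which pairs to 0 with the dual
vector of g; so they cannot pair to 1 and to 0 with it. -/
lemma Transport.unique {v : α} {e f g g' : β} (hv : v ∈ Γ.V) (he : e ∈ Γ.E v)
    (h : Γ.Transport v e f g) (h' : Γ.Transport v e f g') : g = g' := by
  obtain ⟨hg, hge, a, ha⟩ := h
  obtain ⟨hg', hge', a', ha'⟩ := h'
  have hv' := Γ.other_mem hv he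
  by_contra hne
  have h1 := Γ.dual hv' hg hg
  have h2 := Γ.dual hv' hg' hg
  have h3 := Γ.dual hv' (Γ.mem_other hv he) hg
  rw [Γ.W_other hv he, if_neg (Ne.symm hge), neg_dotProduct, neg_eq_zero] at h3
  rw [if_pos rfl, ha, sub_dotProduct, smul_dotProduct, h3] at h1
  rw [if_neg (Ne.symm hne), ha', sub_dotProduct, smul_dotProduct, h3] at h2
  simp only [smul_eq_mul, mul_zero, sub_zero] at h1 h2
  omega

/-- Reindexing by the involution on flags that moves to the other end of the edge. -/
lemma sum_flag {R : Type*} [AddCommMonoid R] (G H : α → β → R)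
    (h : ∀ v ∈ Γ.V, ∀ e ∈ Γ.E v, G v e = H (Γ.other v e) e) :
    ∑ v ∈ Γ.V, ∑ e ∈ Γ.E v, G v e = ∑ v ∈ Γ.V, ∑ e ∈ Γ.E v, H v e := by
  rw [Finset.sum_sigma', Finset.sum_sigma']
  refine Finset.sum_bij' (fun x _ => ⟨Γ.other x.1 x.2, x.2⟩) (fun x _ => ⟨Γ.other x.1 x.2, x.2⟩)
    ?_ ?_ ?_ ?_ ?_
  all_goals
    rintro ⟨v, e⟩ hx
    obtain ⟨hv, he⟩ := Finset.mem_sigma.1 hx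
    dsimp only at hv he ⊢
  · exact Finset.mem_sigma.2 ⟨Γ.other_mem hv he, Γ.mem_other hv he⟩
  · exact Finset.mem_sigma.2 ⟨Γ.other_mem hv he, Γ.mem_other hv he⟩
  · rw [Γ.other_other hv he]
  · rw [Γ.other_other hv he]
  · exact h v hv e he

/-- Transport along e is a bijection between the remaining edges at its two ends: totality, symmetry
and uniqueness make it invertible. -/
lemma sum_transport {R : Type*} [AddCommMonoid R] (G H : α → β → β → R)
    (h : ∀ v ∈ Γ.V, ∀ e ∈ Γ.E v, ∀ f ∈ Γ.E v, f ≠ e → ∀ g, Γ.Transport v e f g →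
      G v e f = H (Γ.other v e) e g) :
    ∑ v ∈ Γ.V, ∑ e ∈ Γ.E v, ∑ f ∈ (Γ.E v).erase e, G v e f =
      ∑ v ∈ Γ.V, ∑ e ∈ Γ.E v, ∑ f ∈ (Γ.E v).erase e, H v e f := by
  refine sum_flag _ _ fun v hv e he => ?_
  have hex : ∀ f : β, ∃ g, f ∈ (Γ.E v).erase e → Γ.Transport v e f g := by
    intro f
    by_cases hf : f ∈ (Γ.E v).erase e
    · obtain ⟨hfe, hf⟩ := Finset.mem_erase.1 hf
      obtain ⟨g, hg⟩ := Γ.exists_transport hv he hf hfe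
      exact ⟨g, fun _ => hg⟩
    · exact ⟨f, fun h => absurd h hf⟩
  choose t ht using hex
  refine Finset.sum_bij (fun f _ => t f) ?_ ?_ ?_ ?_
  · intro f hf
    exact Finset.mem_erase.2 ⟨(ht f hf).2.1, (ht f hf).1⟩
  · intro f hf f' hf' hff
    have h1 := (ht f hf).symm hv he (Finset.mem_of_mem_erase hf) (Finset.ne_of_mem_erase hf)
    have h2 := (ht f' hf').symm hv he (Finset.mem_of_mem_erase hf') (Finset.ne_of_mem_erase hf')
    rw [hff] at h1
    exact h1.unique (Γ.other_mem hv he) (Γ.mem_other hv he) h2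
  · intro g hg
    have hv' := Γ.other_mem hv he
    have he' := Γ.mem_other hv he
    obtain ⟨hge, hg⟩ := Finset.mem_erase.1 hg
    obtain ⟨f, hf⟩ := Γ.exists_transport hv' he' hg hge
    have hf1 := hf
    rw [Γ.other_other hv he] at hf1
    have hfm : f ∈ (Γ.E v).erase e := Finset.mem_erase.2 ⟨hf1.2.1, hf1.1⟩
    refine ⟨f, hfm, ?_⟩
    have h3 := Transport.symm hv' he' hg hge hf
    rw [Γ.other_other hv he] at h3
    exact (ht f hfm).unique hv he h3
  · intro f hf
    exact h v hv e he f (Finset.mem_of_mem_erase hf) (Finset.ne_of_mem_erase hf) _ (ht f hf)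

lemma sum_transport_eq_zero (G : α → β → β → ℚ)
    (h : ∀ v ∈ Γ.V, ∀ e ∈ Γ.E v, ∀ f ∈ Γ.E v, f ≠ e → ∀ g, Γ.Transport v e f g →
      G v e f = - G (Γ.other v e) e g) :
    ∑ v ∈ Γ.V, ∑ e ∈ Γ.E v, ∑ f ∈ (Γ.E v).erase e, G v e f = 0 := by
  have h1 := sum_transport (Γ := Γ) G (fun v e f => - G v e f) h
  simp only [Finset.sum_neg_distrib] at h1
  linarith

lemma sum_pairs_swap (s : Finset β) (X : β → β → ℚ) :
    ∑ e ∈ s, ∑ f ∈ s.erase e, X e f = ∑ e ∈ s, ∑ f ∈ s.erase e, X f e := by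
  refine Finset.sum_comm' ?_
  intro x y
  simp only [Finset.mem_erase]
  tauto

lemma sum_pairs_eq_zero (s : Finset β) (X : β → β → ℚ)
    (h : ∀ e ∈ s, ∀ f ∈ s, f ≠ e → X e f + X f e = 0) :
    ∑ e ∈ s, ∑ f ∈ s.erase e, X e f = 0 := by
  have h1 := sum_pairs_swap s X
  have h2 : ∑ e ∈ s, ∑ f ∈ s.erase e, X e f + ∑ e ∈ s, ∑ f ∈ s.erase e, X f e = 0 := by
    rw [← Finset.sum_add_distrib]
    refine Finset.sum_eq_zero fun e he => ?_
    rw [← Finset.sum_add_distrib]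
    refine Finset.sum_eq_zero fun f hf => ?_
    exact h e he f (Finset.mem_of_mem_erase hf) (Finset.ne_of_mem_erase hf)
  linarith

/-- Noether's formula for toric surfaces, summed over the two-dimensional faces. -/
theorem sum_ratio_eq_sum_sign (ξ : Fin n → ℤ) (hξ : ∀ v ∈ Γ.V, ∀ e ∈ Γ.E v, ξ ⬝ᵥ Γ.W v e ≠ 0) :
    ∑ v ∈ Γ.V, ∑ e ∈ Γ.E v, ∑ f ∈ (Γ.E v).erase e,
        ((ξ ⬝ᵥ Γ.W v f : ℤ) : ℚ) / (ξ ⬝ᵥ Γ.W v e : ℤ) =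
      3 / 2 * ∑ v ∈ Γ.V, ∑ e ∈ Γ.E v, ∑ f ∈ (Γ.E v).erase e,
        ((ξ ⬝ᵥ Γ.W v f).sign : ℚ) * ((ξ ⬝ᵥ Γ.W v e).sign : ℚ) := by
  classical
  -- A second functional, generic relative to ξ, keeps the denominators of `T` nonzero.
  obtain ⟨η, hη⟩ : ∃ η : Fin n → ℤ, ∀ v ∈ Γ.V, ∀ e ∈ Γ.E v, ∀ f ∈ Γ.E v, f ≠ e →
      (η ⬝ᵥ Γ.W v e) * (ξ ⬝ᵥ Γ.W v f) - (η ⬝ᵥ Γ.W v f) * (ξ ⬝ᵥ Γ.W v e) ≠ 0 := by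
    obtain ⟨η, hη⟩ := exists_generic (Γ.V.biUnion fun v => (Γ.E v).biUnion fun e =>
        ((Γ.E v).erase e).image fun f =>
          (ξ ⬝ᵥ Γ.W v f) • Γ.W v e - (ξ ⬝ᵥ Γ.W v e) • Γ.W v f) (by
      intro u hu
      simp only [Finset.mem_biUnion, Finset.mem_image, Finset.mem_erase] at hu
      obtain ⟨v, hv, e, he, f, ⟨hfe, hf⟩, rfl⟩ := hu
      intro h0
      have h1 := congrArg (fun x => x ⬝ᵥ Γ.D v e) h0
      simp only [sub_dotProduct, smul_dotProduct, Γ.dual hv he he, Γ.dual hv hf he,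
        if_neg hfe, if_pos, zero_dotProduct] at h1
      simp [hξ v hv f hf] at h1)
    refine ⟨η, fun v hv e he f hf hfe => ?_⟩
    have h1 := hη ((ξ ⬝ᵥ Γ.W v f) • Γ.W v e - (ξ ⬝ᵥ Γ.W v e) • Γ.W v f) (by
      simp only [Finset.mem_biUnion, Finset.mem_image, Finset.mem_erase]
      exact ⟨v, hv, e, he, f, ⟨hfe, hf⟩, rfl⟩)
    rw [dotProduct_sub, dotProduct_smul, dotProduct_smul] at h1
    simp only [smul_eq_mul] at h1
    rwa [mul_comm (ξ ⬝ᵥ Γ.W v f), mul_comm (ξ ⬝ᵥ Γ.W v e)] at h1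
  let m : α → β → ℤ := fun v e => ξ ⬝ᵥ Γ.W v e
  let y : α → β → ℤ := fun v e => η ⬝ᵥ Γ.W v e
  -- `T` splits the gcd² term of reciprocity as T(e, f) + T(f, e) = gcd²/(m_e m_f), with each piece
  -- changing sign under transport along its first edge. The gcd and, up to sign, the denominator
  -- are unaffected by transport.
  let T : α → β → β → ℚ := fun v e f =>
    (Int.gcd (m v e) (m v f) : ℚ) ^ 2 * ((y v e : ℚ) / m v e) /
      ((y v e : ℚ) * m v f - y v f * m v e)
  have htm : ∀ v ∈ Γ.V, ∀ e ∈ Γ.E v, ∀ f g, Γ.Transport v e f g →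
      ∃ a : ℤ, m (Γ.other v e) e = - m v e ∧ y (Γ.other v e) e = - y v e ∧
        m (Γ.other v e) g = m v f - a * m v e ∧ y (Γ.other v e) g = y v f - a * y v e := by
    rintro v hv e he f g ⟨_, _, a, ha⟩
    refine ⟨a, ?_, ?_, ?_, ?_⟩ <;> simp only [m, y]
    · rw [Γ.W_other hv he, dotProduct_neg]
    · rw [Γ.W_other hv he, dotProduct_neg]
    · rw [ha, dotProduct_sub, dotProduct_smul, smul_eq_mul]
    · rw [ha, dotProduct_sub, dotProduct_smul, smul_eq_mul]
  have hD : ∑ v ∈ Γ.V, ∑ e ∈ Γ.E v, ∑ f ∈ (Γ.E v).erase e, dedekind (m v f) (m v e) = 0 := by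
    refine sum_transport_eq_zero (fun v e f => dedekind (m v f) (m v e)) ?_
    intro v hv e he f hf hfe g hg
    obtain ⟨a, h1, -, h2, -⟩ := htm v hv e he f g hg
    rw [h1, dedekind_neg_right, neg_neg, dedekind_congr h2]
  have hT : ∑ v ∈ Γ.V, ∑ e ∈ Γ.E v, ∑ f ∈ (Γ.E v).erase e, T v e f = 0 := by
    refine sum_transport_eq_zero T ?_
    intro v hv e he f hf hfe g hg
    obtain ⟨a, h1, h2, h3, h4⟩ := htm v hv e he f g hg
    have hg : Int.gcd (m (Γ.other v e) e) (m (Γ.other v e) g) = Int.gcd (m v e) (m v f) := by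
      rw [h1, h3, Int.neg_gcd]
      have : m v f - a * m v e = m v f + m v e * (-a) := by ring
      rw [this, Int.gcd_add_mul_left_right]
    simp only [T]
    rw [hg, h1, h2, h3, h4]
    push_cast
    have : (-(y v e : ℚ)) * (m v f - a * m v e) - (y v f - a * y v e) * -(m v e) =
      -((y v e : ℚ) * m v f - y v f * m v e) := by ring
    rw [this, neg_div_neg_eq, div_neg, neg_neg]
  -- Reciprocity says that this summand is antisymmetric in e and f, so the sum vanishes at each
  -- vertex separately.
  have hX : ∑ v ∈ Γ.V, ∑ e ∈ Γ.E v, ∑ f ∈ (Γ.E v).erase e,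
      ((m v f : ℚ) / m v e - 12 * dedekind (m v f) (m v e) + T v e f
        - 3 / 2 * (((m v f).sign : ℚ) * ((m v e).sign : ℚ))) = 0 := by
    refine Finset.sum_eq_zero fun v hv => ?_
    refine sum_pairs_eq_zero _ (fun e f => (m v f : ℚ) / m v e - 12 * dedekind (m v f) (m v e)
      + T v e f - 3 / 2 * (((m v f).sign : ℚ) * ((m v e).sign : ℚ))) ?_
    intro e he f hf hfe
    have me : m v e ≠ 0 := hξ v hv e he
    have mf : m v f ≠ 0 := hξ v hv f hf
    have h1 := dedekind_add mf me
    have hd : (y v e : ℚ) * m v f - y v f * m v e ≠ 0 := by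
      exact_mod_cast hη v hv e he f hf hfe
    have me' : (m v e : ℚ) ≠ 0 := by exact_mod_cast me
    have mf' : (m v f : ℚ) ≠ 0 := by exact_mod_cast mf
    have h2 : T v e f + T v f e = (Int.gcd (m v f) (m v e) : ℚ) ^ 2 / (m v f * m v e) := by
      simp only [T]
      rw [Int.gcd_comm (m v e)]
      have : (y v f : ℚ) * m v e - y v e * m v f = -((y v e : ℚ) * m v f - y v f * m v e) := by
        ring
      rw [this, div_neg]
      generalize (Int.gcd (m v f) (m v e) : ℚ) = g
      set d := (y v e : ℚ) * m v f - y v f * m v e with hdd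
      field_simp
      rw [hdd]
      ring
    linear_combination h2 - 12 * h1
  simp only [Finset.sum_sub_distrib, Finset.sum_add_distrib, ← Finset.mul_sum, hD, hT] at hX
  simp only [m] at hX
  linarith

end LatticeGraph

end DelzantReflexive

/-! ### Vertices of polytopes and the cone of edges at a vertex. -/

namespace DelzantReflexive

section Cone

variable {E : Type*} [AddCommGroup E] [Module ℝ E]

/-- `x` is a nonnegative combination of the vectors in `A`. -/
def InCone (A : Finset E) (x : E) : Prop :=
  ∃ c : E → ℝ, (∀ a, 0 ≤ c a) ∧ x = ∑ a ∈ A, c a • a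

lemma InCone.erase [DecidableEq E] {A : Finset E} {a x : E} (ha : a ∈ A)
    (h : InCone (A.erase a) a) (hx : InCone A x) : InCone (A.erase a) x := by
  obtain ⟨d, hd, hda⟩ := h
  obtain ⟨c, hc, rfl⟩ := hx
  refine ⟨fun b => c b + c a * d b, fun b => add_nonneg (hc b) (mul_nonneg (hc a) (hd b)), ?_⟩
  rw [← Finset.add_sum_erase A _ ha]
  nth_rewrite 2 [hda]
  rw [Finset.smul_sum, ← Finset.sum_add_distrib]
  refine Finset.sum_congr rfl fun b _ => ?_
  rw [smul_smul, add_smul, add_comm]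

/-- A redundant generator can be dropped without changing the cone; finiteness ends the process. -/
lemma exists_minimal_generators [DecidableEq E] (G : Finset E) (X : Set E)
    (h : ∀ x ∈ X, InCone G x) :
    ∃ A ⊆ G, (∀ x ∈ X, InCone A x) ∧ ∀ a ∈ A, ¬ InCone (A.erase a) a := by
  induction G using Finset.strongInduction with
  | H G ih =>
    by_cases hG : ∀ a ∈ G, ¬ InCone (G.erase a) a
    · exact ⟨G, subset_rfl, h, hG⟩
    · push Not at hG
      obtain ⟨a, ha, hcone⟩ := hG
      obtain ⟨A, hA, h1, h2⟩ := ih (G.erase a) (Finset.erase_ssubset ha)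
        fun x hx => InCone.erase ha hcone (h x hx)
      exact ⟨A, hA.trans (Finset.erase_subset _ _), h1, h2⟩

end Cone

/-- A member of a minimal generating set of a pointed cone spans an exposed ray. -/
lemma exists_exposing_ray {n : ℕ} [DecidableEq (Fin n → ℝ)] {A : Finset (Fin n → ℝ)}
    {a : Fin n → ℝ} (φ : StrongDual ℝ (Fin n → ℝ)) (hφ : ∀ b ∈ A, φ b < 0) (ha : a ∈ A)
    (hmin : ¬ InCone (A.erase a) a) :
    ∃ ψ : StrongDual ℝ (Fin n → ℝ), ψ a = 0 ∧ ∀ b ∈ A, b ≠ a → ψ b < 0 := by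
  let L : Submodule ℝ (Fin n → ℝ) := Submodule.span ℝ {a}
  -- A positive multiple of a in the hull would make a redundant; a nonpositive multiple is excluded
  -- by φ < 0 on the generators. So the hull can be separated from the line ℝa.
  have hdisj : Disjoint (convexHull ℝ (A.erase a : Set (Fin n → ℝ))) (L : Set (Fin n → ℝ)) := by
    rw [Set.disjoint_left]
    intro y hy hyL
    obtain ⟨w, hw0, hw1, hwy⟩ := Finset.mem_convexHull'.1 hy
    obtain ⟨t, rfl⟩ := Submodule.mem_span_singleton.1 hyL
    rcases lt_or_ge 0 t with ht | ht
    · refine hmin ⟨fun b => if b ∈ A.erase a then t⁻¹ * w b else 0, fun b => ?_, ?_⟩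
      · dsimp only
        split_ifs with hb
        · exact mul_nonneg (inv_nonneg.2 ht.le) (hw0 b hb)
        · exact le_rfl
      · have h1 : a = t⁻¹ • ∑ b ∈ A.erase a, w b • b := by rw [hwy, inv_smul_smul₀ ht.ne']
        rw [Finset.smul_sum] at h1
        refine h1.trans ?_
        refine Finset.sum_congr rfl fun b hb => ?_
        dsimp only
        rw [if_pos hb, smul_smul]
    · have h1 : 0 ≤ φ (t • a) := by
        rw [map_smul, smul_eq_mul]
        exact mul_nonneg_of_nonpos_of_nonpos ht (hφ a ha).le
      have h2 : φ (t • a) < 0 := by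
        have hsub : convexHull ℝ (A.erase a : Set (Fin n → ℝ)) ⊆ {x | φ x < 0} := by
          refine convexHull_min ?_ (convex_halfSpace_lt φ.toLinearMap.isLinear 0)
          intro b hb
          exact hφ b (Finset.mem_of_mem_erase hb)
        exact hsub hy
      linarith
  obtain ⟨ψ, u, r, h1, hur, h2⟩ := geometric_hahn_banach_compact_closed
    (convex_convexHull ℝ _) ((A.erase a).finite_toSet.isCompact_convexHull ℝ)
    L.convex L.closed_of_finiteDimensional hdisj
  have h0 : r < 0 := by simpa using h2 0 L.zero_mem
  -- A functional bounded below on a line through 0 vanishes on it.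
  have hψa : ψ a = 0 := by
    by_contra hne
    have := h2 ((r / ψ a) • a) (Submodule.mem_span_singleton.2 ⟨_, rfl⟩)
    rw [map_smul, smul_eq_mul, div_mul_cancel₀ _ hne] at this
    exact lt_irrefl _ this
  refine ⟨ψ, hψa, fun b hb hba => ?_⟩
  have := h1 b (subset_convexHull ℝ _ (Finset.mem_coe.2 (Finset.mem_erase.2 ⟨hba, hb⟩)))
  linarith

lemma dim_eq {n : ℕ} (F : Set (Fin n → ℝ)) : dim F = Module.finrank ℝ (vectorSpan ℝ F) := by
  rw [dim, direction_affineSpan]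

lemma dim_singleton {n : ℕ} (v : Fin n → ℝ) : dim {v} = 0 := by
  rw [dim_eq, vectorSpan_singleton, finrank_bot]

namespace IsPolytope

variable {n : ℕ} {P : Set (Fin n → ℝ)}

lemma isCompact (hP : IsPolytope P) : IsCompact P := by
  obtain ⟨S, rfl⟩ := hP
  exact S.finite_toSet.isCompact_convexHull ℝ

lemma convex (hP : IsPolytope P) : Convex ℝ P := by
  obtain ⟨S, rfl⟩ := hP
  exact convex_convexHull ℝ _

lemma finite_extremePoints (hP : IsPolytope P) : (P.extremePoints ℝ).Finite := by
  obtain ⟨S, rfl⟩ := hP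
  exact S.finite_toSet.subset extremePoints_convexHull_subset

/-- An extreme point is outside the hull of the other generators, hence strictly separated from
them, and the strict inequality passes to convex combinations. -/
lemma exists_exposing (hP : IsPolytope P) {v : Fin n → ℝ} (hv : v ∈ P.extremePoints ℝ) :
    ∃ φ : StrongDual ℝ (Fin n → ℝ), ∀ x ∈ P, x ≠ v → φ x < φ v := by
  classical
  obtain ⟨S, rfl⟩ := id hP
  have hvS : v ∈ S := extremePoints_convexHull_subset hv
  have hnot : v ∉ convexHull ℝ (S.erase v : Set (Fin n → ℝ)) := by
    intro hmem
    have h1 := ((convex_convexHull ℝ _).mem_extremePoints_iff_convex_sdiff.1 hv).2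
    have h2 := convexHull_min (s := (S.erase v : Set (Fin n → ℝ))) (fun x hx => by
      have hx' := Finset.mem_erase.1 (Finset.mem_coe.1 hx)
      exact ⟨subset_convexHull ℝ _ (Finset.mem_coe.2 hx'.2), hx'.1⟩) h1 hmem
    exact h2.2 rfl
  obtain ⟨φ, u, h1, h2⟩ := geometric_hahn_banach_closed_point (convex_convexHull ℝ _)
    ((S.erase v).finite_toSet.isClosed_convexHull ℝ) hnot
  have h3 : ∀ s ∈ S, s ≠ v → φ s < φ v := fun s hs hsv =>
    (h1 s (subset_convexHull ℝ _ (Finset.mem_coe.2 (Finset.mem_erase.2 ⟨hsv, hs⟩)))).trans h2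
  refine ⟨φ, fun x hx hxv => ?_⟩
  obtain ⟨w, hw0, hw1, rfl⟩ := Finset.mem_convexHull'.1 hx
  have h4 : φ v = ∑ s ∈ S, w s * φ v := by rw [← Finset.sum_mul, hw1, one_mul]
  rw [h4, map_sum]
  simp only [map_smul, smul_eq_mul]
  refine Finset.sum_lt_sum ?_ ?_
  · intro s hs
    by_cases hsv : s = v
    · rw [hsv]
    · exact mul_le_mul_of_nonneg_left (h3 s hs hsv).le (hw0 s hs)
  · by_contra! hcon
    apply hxv
    have hw : ∀ s ∈ S, s ≠ v → w s = 0 := by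
      intro s hs hsv
      have := hcon s hs
      by_contra hne
      have hpos := lt_of_le_of_ne (hw0 s hs) (Ne.symm hne)
      have := mul_lt_mul_of_pos_left (h3 s hs hsv) hpos
      linarith
    have hwv : w v = 1 := by
      rw [← hw1]
      exact (Finset.sum_eq_single v hw (fun h => absurd hvS h)).symm
    rw [Finset.sum_eq_single v (fun s hs hsv => by rw [hw s hs hsv, zero_smul])
      (fun h => absurd hvS h), hwv, one_smul]

lemma vertices_eq (hP : IsPolytope P) : vertices P = P.extremePoints ℝ := by
  ext v
  constructor
  · rintro ⟨h, -, -⟩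
    exact isExtreme_singleton.1 h.isExtreme
  · intro hv
    obtain ⟨φ, hφ⟩ := hP.exists_exposing hv
    refine ⟨fun _ => ⟨φ, ?_⟩, Set.singleton_nonempty v, dim_singleton v⟩
    ext x
    constructor
    · rintro rfl
      refine ⟨hv.1, fun y hy => ?_⟩
      by_cases hyv : y = x
      · rw [hyv]
      · exact (hφ y hy hyv).le
    · rintro ⟨hx, h⟩
      by_contra hne
      exact absurd (h v hv.1) (not_le.2 (hφ x hx hne))

/-- A polytope lies in the cone spanned by the edges at a vertex. -/
lemma exists_cone (hP : IsPolytope P) {v : Fin n → ℝ} (hv : v ∈ vertices P) :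
    ∃ A : Finset (Fin n → ℝ), (∀ a ∈ A, ∃ e ∈ edgesAt P v, v + a ∈ e) ∧
      ∀ x ∈ P, InCone A (x - v) := by
  classical
  rw [hP.vertices_eq] at hv
  obtain ⟨φ, hφ⟩ := hP.exists_exposing hv
  obtain ⟨S, hS⟩ := id hP
  let G : Finset (Fin n → ℝ) := (S.erase v).image (fun s => s - v)
  have hG : ∀ x ∈ (fun x => x - v) '' P, InCone G x := by
    rintro _ ⟨x, hx, rfl⟩
    rw [hS] at hx
    obtain ⟨w, hw0, hw1, rfl⟩ := Finset.mem_convexHull'.1 hx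
    refine ⟨fun g => if g + v ∈ S then w (g + v) else 0, fun g => ?_, ?_⟩
    · dsimp only
      split_ifs with h
      · exact hw0 _ h
      · exact le_rfl
    · rw [Finset.sum_image (fun x _ y _ h => sub_left_injective h)]
      have h1 : ∑ s ∈ S, w s • s - v = ∑ s ∈ S, w s • (s - v) := by
        simp only [smul_sub, Finset.sum_sub_distrib, ← Finset.sum_smul, hw1, one_smul]
      refine h1.trans ?_
      dsimp only
      by_cases hvS : v ∈ S
      · rw [← Finset.add_sum_erase S _ hvS, sub_self, smul_zero, zero_add]
        refine Finset.sum_congr rfl fun s hs => ?_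
        rw [sub_add_cancel, if_pos (Finset.mem_of_mem_erase hs)]
      · rw [Finset.erase_eq_of_notMem hvS]
        refine Finset.sum_congr rfl fun s hs => ?_
        rw [sub_add_cancel, if_pos hs]
  obtain ⟨A, hAG, hA, hmin⟩ := exists_minimal_generators G _ hG
  have hAP : ∀ a ∈ A, v + a ∈ P ∧ a ≠ 0 := by
    intro a ha
    obtain ⟨s, hs, rfl⟩ := Finset.mem_image.1 (hAG ha)
    obtain ⟨hsv, hs⟩ := Finset.mem_erase.1 hs
    rw [add_sub_cancel, hS]
    exact ⟨subset_convexHull ℝ _ hs, sub_ne_zero.2 hsv⟩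
  have hneg : ∀ a ∈ A, φ a < 0 := by
    intro a ha
    have := hφ _ (hAP a ha).1 (by simpa using (hAP a ha).2)
    rw [map_add] at this
    linarith
  refine ⟨A, fun a ha => ?_, fun x hx => hA _ ⟨x, hx, rfl⟩⟩
  obtain ⟨ψ, hψa, hψ⟩ := exists_exposing_ray φ hneg ha (hmin a ha)
  have hcoef : ∀ x ∈ P, ψ x ≤ ψ v ∧ (ψ x = ψ v → ∃ t : ℝ, x = v + t • a) := by
    intro x hx
    obtain ⟨c, hc, hxc⟩ := hA _ ⟨x, hx, rfl⟩
    dsimp only at hxc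
    have h1 : ψ x - ψ v = ∑ b ∈ A.erase a, c b * ψ b := by
      rw [← map_sub, hxc, map_sum, ← Finset.add_sum_erase A _ ha]
      simp [hψa]
    have hle : ∀ b ∈ A.erase a, c b * ψ b ≤ 0 := by
      intro b hb
      obtain ⟨hba, hb⟩ := Finset.mem_erase.1 hb
      exact mul_nonpos_of_nonneg_of_nonpos (hc b) (hψ b hb hba).le
    refine ⟨by linarith [Finset.sum_nonpos hle], fun heq => ?_⟩
    have h2 := (Finset.sum_eq_zero_iff_of_nonpos hle).1 (by rw [← h1, heq, sub_self])
    refine ⟨c a, ?_⟩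
    have h3 : ∑ b ∈ A.erase a, c b • b = 0 := by
      refine Finset.sum_eq_zero fun b hb => ?_
      obtain ⟨hba, hb'⟩ := Finset.mem_erase.1 hb
      rcases mul_eq_zero.1 (h2 b hb) with h | h
      · rw [h, zero_smul]
      · exact absurd h (hψ b hb' hba).ne
    rw [← Finset.add_sum_erase A _ ha, h3, add_zero] at hxc
    rw [← hxc]
    abel
  -- Over the cone at v, ψ is nonpositive and vanishes only along a, so this exposed face lies on
  -- the line v + ℝa and is an edge.
  let e : Set (Fin n → ℝ) := {x ∈ P | ∀ y ∈ P, ψ y ≤ ψ x}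
  have hve : v ∈ e := ⟨hv.1, fun y hy => (hcoef y hy).1⟩
  have hae : v + a ∈ e := by
    refine ⟨(hAP a ha).1, fun y hy => ?_⟩
    rw [map_add, hψa, add_zero]
    exact (hcoef y hy).1
  have hline : ∀ x ∈ e, ∃ t : ℝ, x = v + t • a := fun x hx =>
    (hcoef x hx.1).2 (le_antisymm (hcoef x hx.1).1 (hx.2 v hv.1))
  have hspan : vectorSpan ℝ e = Submodule.span ℝ {a} := by
    apply le_antisymm
    · rw [vectorSpan, Submodule.span_le]
      rintro _ ⟨x, hx, y, hy, rfl⟩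
      obtain ⟨s, rfl⟩ := hline x hx
      obtain ⟨t, rfl⟩ := hline y hy
      refine Submodule.mem_span_singleton.2 ⟨s - t, ?_⟩
      simp only [vsub_eq_sub, sub_smul]
      abel
    · rw [Submodule.span_singleton_le_iff_mem]
      simpa using vsub_mem_vectorSpan ℝ hae hve
  refine ⟨e, ⟨⟨fun _ => ⟨ψ, rfl⟩, ⟨v, hve⟩, ?_⟩, hve⟩, hae⟩
  rw [dim_eq, hspan, finrank_span_singleton (hAP a ha).2]

end IsPolytope

end DelzantReflexive

/-! ### Lattice coordinates at a vertex, and faces as coordinate faces. -/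

namespace DelzantReflexive

section ToReal

variable {n : ℕ}

lemma toReal_neg (u : Fin n → ℤ) : toReal (-u) = - toReal u := by
  funext i; simp [toReal]

lemma toReal_sub (u w : Fin n → ℤ) : toReal (u - w) = toReal u - toReal w := by
  funext i; simp [toReal]

lemma toReal_smul (a : ℤ) (u : Fin n → ℤ) : toReal (a • u) = (a : ℝ) • toReal u := by
  funext i; simp [toReal]

lemma toReal_injective : Function.Injective (toReal (n := n)) := by
  intro u w h
  funext i
  have := congrFun h i
  simpa [toReal] using this

lemma toReal_dotProduct (u w : Fin n → ℤ) : toReal u ⬝ᵥ toReal w = ((u ⬝ᵥ w : ℤ) : ℝ) := by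
  simp [toReal, dotProduct]

/-- The functional `x ↦ ⟨x, u⟩`. -/
noncomputable def dotFunctional (u : Fin n → ℝ) : StrongDual ℝ (Fin n → ℝ) :=
  LinearMap.toContinuousLinearMap
    { toFun := fun x => x ⬝ᵥ u
      map_add' := fun x y => add_dotProduct x y u
      map_smul' := fun a x => by simp [smul_dotProduct] }

@[simp] lemma dotFunctional_apply (u x : Fin n → ℝ) : dotFunctional u x = x ⬝ᵥ u := rfl

end ToReal

/-- The edges at `v` as a finite set. -/
noncomputable def edgeFinset {n : ℕ} (P : Set (Fin n → ℝ)) (v : Fin n → ℝ) :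
    Finset (Set (Fin n → ℝ)) :=
  open Classical in if h : (edgesAt P v).Finite then h.toFinset else ∅

namespace IsDelzant

variable {n : ℕ} {P : Set (Fin n → ℝ)}

/-- The primitive vector along the edge `e` at the vertex `v`. -/
noncomputable def edgeVec (hD : IsDelzant P) (v : Fin n → ℝ) (e : Set (Fin n → ℝ)) : Fin n → ℤ :=
  open Classical in
  if h : v ∈ vertices P ∧ e ∈ edgesAt P v then (hD.smooth v h.1).choose ⟨e, h.2⟩ else 0

/-- The members of the basis dual to the edge vectors at `v`. -/
noncomputable def dualVec (hD : IsDelzant P) (v : Fin n → ℝ) (e : Set (Fin n → ℝ)) : Fin n → ℤ :=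
  open Classical in
  if h : v ∈ vertices P ∧ e ∈ edgesAt P v then
    fun i => (hD.smooth v h.1).choose.coord ⟨e, h.2⟩ (Pi.single i 1) else 0

variable {v : Fin n → ℝ} {e f : Set (Fin n → ℝ)}

lemma finite_edgesAt (hD : IsDelzant P) (hv : v ∈ vertices P) : (edgesAt P v).Finite :=
  Set.finite_coe_iff.1 (Module.Finite.finite_basis (hD.smooth v hv).choose)

lemma mem_edgeFinset (hD : IsDelzant P) (hv : v ∈ vertices P) :
    e ∈ edgeFinset P v ↔ e ∈ edgesAt P v := by
  rw [edgeFinset, dif_pos (hD.finite_edgesAt hv), Set.Finite.mem_toFinset]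

lemma card_edgeFinset (hD : IsDelzant P) (hv : v ∈ vertices P) : (edgeFinset P v).card = n := by
  rw [edgeFinset, dif_pos (hD.finite_edgesAt hv), ← Set.ncard_eq_toFinset_card _ (hD.finite_edgesAt hv), hD.simple v hv]

lemma edgeVec_eq (hD : IsDelzant P) (hv : v ∈ vertices P) (e : edgesAt P v) :
    hD.edgeVec v e = (hD.smooth v hv).choose e := by
  rw [edgeVec, dif_pos ⟨hv, e.2⟩]

lemma dotProduct_dualVec (hD : IsDelzant P) (hv : v ∈ vertices P) (e : edgesAt P v)
    (u : Fin n → ℤ) : u ⬝ᵥ hD.dualVec v e = (hD.smooth v hv).choose.coord e u := by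
  rw [dualVec, dif_pos ⟨hv, e.2⟩]
  conv_rhs => rw [pi_eq_sum_univ' u]
  simp only [map_sum, map_smul, smul_eq_mul, dotProduct]

lemma edgeVec_dotProduct_dualVec (hD : IsDelzant P) (hv : v ∈ vertices P) (he : e ∈ edgesAt P v)
    (hf : f ∈ edgesAt P v) [Decidable (e = f)] :
    hD.edgeVec v e ⬝ᵥ hD.dualVec v f = if e = f then 1 else 0 := by
  classical
  have h1 := hD.dotProduct_dualVec hv ⟨f, hf⟩ (hD.edgeVec v e)
  have h2 := hD.edgeVec_eq hv ⟨e, he⟩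
  dsimp only at h1 h2
  rw [h1, h2]
  simp [Finsupp.single_apply]

lemma toReal_edgeVec_dotProduct_dualVec (hD : IsDelzant P) (hv : v ∈ vertices P)
    (he : e ∈ edgesAt P v) (hf : f ∈ edgesAt P v) [Decidable (e = f)] :
    toReal (hD.edgeVec v e) ⬝ᵥ toReal (hD.dualVec v f) = if e = f then 1 else 0 := by
  rw [toReal_dotProduct, hD.edgeVec_dotProduct_dualVec hv he hf]
  split_ifs <;> simp

lemma sum_smul_edgeVec (hD : IsDelzant P) (hv : v ∈ vertices P) (u : Fin n → ℤ) :
    ∑ e ∈ edgeFinset P v, (u ⬝ᵥ hD.dualVec v e) • hD.edgeVec v e = u := by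
  classical
  have : Fintype (edgesAt P v) := (hD.finite_edgesAt hv).fintype
  have h1 := (hD.smooth v hv).choose.sum_repr u
  conv_rhs => rw [← h1]
  refine (Finset.sum_subtype (p := fun e => e ∈ edgesAt P v) (edgeFinset P v)
    (fun e => hD.mem_edgeFinset hv) _).trans (Finset.sum_congr rfl fun e _ => ?_)
  rw [hD.edgeVec_eq hv, hD.dotProduct_dualVec hv]
  rfl

lemma sum_smul_toReal_edgeVec (hD : IsDelzant P) (hv : v ∈ vertices P) (x : Fin n → ℝ) :
    ∑ e ∈ edgeFinset P v, (x ⬝ᵥ toReal (hD.dualVec v e)) • toReal (hD.edgeVec v e) = x := by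
  funext j
  have key : ∀ i : Fin n, ∑ e ∈ edgeFinset P v,
      (hD.dualVec v e i : ℝ) * (hD.edgeVec v e j : ℝ) = if i = j then 1 else 0 := by
    intro i
    have h1 := congrFun (hD.sum_smul_edgeVec hv (Pi.single i 1)) j
    simp only [Finset.sum_apply, Pi.smul_apply, smul_eq_mul, single_dotProduct, one_mul,
      Pi.single_apply] at h1
    have h2 := congrArg (Int.cast (R := ℝ)) h1
    push_cast at h2
    rw [h2]
    simp only [eq_comm]
  simp only [Finset.sum_apply, Pi.smul_apply, smul_eq_mul, dotProduct, Finset.sum_mul, toReal]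
  rw [Finset.sum_comm]
  simp only [mul_assoc, ← Finset.mul_sum, key]
  simp

/-- The coordinate of `x` along the edge `e` in the frame at `v`. -/
noncomputable def coord (hD : IsDelzant P) (v : Fin n → ℝ) (e : Set (Fin n → ℝ))
    (x : Fin n → ℝ) : ℝ :=
  (x - v) ⬝ᵥ toReal (hD.dualVec v e)

lemma coord_add_smul (hD : IsDelzant P) (x y : Fin n → ℝ) (t : ℝ) :
    hD.coord v e (x + t • y) = hD.coord v e x + t * (y ⬝ᵥ toReal (hD.dualVec v e)) := by
  rw [coord, coord, add_sub_right_comm, add_dotProduct, smul_dotProduct, smul_eq_mul]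

@[simp] lemma coord_self (hD : IsDelzant P) : hD.coord v e v = 0 := by
  simp [coord]

lemma eq_add_sum_coord (hD : IsDelzant P) (hv : v ∈ vertices P) (x : Fin n → ℝ) :
    x = v + ∑ e ∈ edgeFinset P v, hD.coord v e x • toReal (hD.edgeVec v e) := by
  simp only [coord]
  rw [hD.sum_smul_toReal_edgeVec hv]
  abel

lemma pointsAlong (hD : IsDelzant P) (hv : v ∈ vertices P) (he : e ∈ edgesAt P v) :
    PointsAlong e v (hD.edgeVec v e) := by
  have h1 := (hD.smooth v hv).choose_spec ⟨e, he⟩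
  have h2 := hD.edgeVec_eq hv ⟨e, he⟩
  dsimp only at h2
  rw [h2]
  exact h1

lemma coord_of_mem_edge (hD : IsDelzant P) (hv : v ∈ vertices P) (he : e ∈ edgesAt P v)
    {x : Fin n → ℝ} (hx : x ∈ e) :
    0 ≤ hD.coord v e x ∧ x = v + hD.coord v e x • toReal (hD.edgeVec v e) := by
  classical
  obtain ⟨t, ht, hxt⟩ := hD.pointsAlong hv he x hx
  have : hD.coord v e x = t := by
    rw [hxt, coord_add_smul, coord_self, hD.toReal_edgeVec_dotProduct_dualVec hv he he]
    simp
  rw [this]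
  exact ⟨ht, hxt⟩

lemma mem_of_mem_edge (he : e ∈ edgesAt P v) {x : Fin n → ℝ} (hx : x ∈ e) : x ∈ P :=
  he.1.1.subset hx

lemma exists_coord_pos (hD : IsDelzant P) (hv : v ∈ vertices P) (he : e ∈ edgesAt P v) :
    ∃ x ∈ e, 0 < hD.coord v e x := by
  by_contra! h
  have : e = {v} := by
    ext x
    constructor
    · intro hx
      obtain ⟨h1, h2⟩ := hD.coord_of_mem_edge hv he hx
      rw [le_antisymm (h x hx) h1, zero_smul, add_zero] at h2
      exact h2
    · rintro rfl
      exact he.2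
  have h2 := he.1.2.2
  rw [this, dim_singleton] at h2
  exact absurd h2 (by norm_num)

/-- P lies in the cone of the edges at v, and along each edge every coordinate is nonnegative by
duality. Thus all of P sits in the orthant of the frame at v. -/
lemma coord_nonneg (hD : IsDelzant P) (hv : v ∈ vertices P) (he : e ∈ edgesAt P v)
    {x : Fin n → ℝ} (hx : x ∈ P) : 0 ≤ hD.coord v e x := by
  classical
  obtain ⟨A, hA, hcone⟩ := hD.polytope.exists_cone hv
  obtain ⟨c, hc, hxc⟩ := hcone x hx
  rw [coord, hxc, sum_dotProduct]
  refine Finset.sum_nonneg fun a ha => ?_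
  obtain ⟨f, hf, haf⟩ := hA a ha
  obtain ⟨t, ht, hat⟩ := hD.pointsAlong hv hf _ haf
  have : a = t • toReal (hD.edgeVec v f) := by simpa using hat
  rw [this, smul_dotProduct, smul_dotProduct, hD.toReal_edgeVec_dotProduct_dualVec hv hf he]
  have := hc (t • toReal (hD.edgeVec v f))
  split_ifs <;> simp only [smul_eq_mul] <;> positivity

lemma coord_of_mem_other_edge (hD : IsDelzant P) (hv : v ∈ vertices P) (he : e ∈ edgesAt P v)
    (hf : f ∈ edgesAt P v) (hfe : f ≠ e) {x : Fin n → ℝ} (hx : x ∈ e) : hD.coord v f x = 0 := by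
  classical
  rw [(hD.coord_of_mem_edge hv he hx).2, coord_add_smul, coord_self,
    hD.toReal_edgeVec_dotProduct_dualVec hv he hf, if_neg (Ne.symm hfe)]
  simp

/-- The face through `v` spanned by the edges in `S`. -/
def coordFace (hD : IsDelzant P) (v : Fin n → ℝ) (S : Finset (Set (Fin n → ℝ))) :
    Set (Fin n → ℝ) :=
  {x ∈ P | ∀ e ∈ edgesAt P v, e ∉ S → hD.coord v e x = 0}

lemma mem_of_vertex (hv : v ∈ vertices P) : v ∈ P := hv.1.subset rfl

lemma self_mem_coordFace (hD : IsDelzant P) (hv : v ∈ vertices P)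
    (S : Finset (Set (Fin n → ℝ))) : v ∈ hD.coordFace v S :=
  ⟨mem_of_vertex hv, fun _ _ _ => hD.coord_self⟩

lemma edge_subset_coordFace (hD : IsDelzant P) (hv : v ∈ vertices P) (he : e ∈ edgesAt P v)
    {S : Finset (Set (Fin n → ℝ))} (heS : e ∈ S) : e ⊆ hD.coordFace v S := by
  intro x hx
  exact ⟨mem_of_mem_edge he hx, fun f hf hfS =>
    hD.coord_of_mem_other_edge hv he hf (fun h => hfS (h ▸ heS)) hx⟩

lemma mem_of_edge_subset_coordFace (hD : IsDelzant P) (hv : v ∈ vertices P)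
    (he : e ∈ edgesAt P v) {S : Finset (Set (Fin n → ℝ))} (h : e ⊆ hD.coordFace v S) : e ∈ S := by
  by_contra heS
  obtain ⟨x, hx, hpos⟩ := hD.exists_coord_pos hv he
  exact hpos.ne' ((h hx).2 e he heS)

lemma eq_add_sum_of_mem_coordFace (hD : IsDelzant P) (hv : v ∈ vertices P)
    {S : Finset (Set (Fin n → ℝ))} (hS : S ⊆ edgeFinset P v) {x : Fin n → ℝ}
    (hx : x ∈ hD.coordFace v S) :
    x = v + ∑ e ∈ S, hD.coord v e x • toReal (hD.edgeVec v e) := by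
  conv_lhs => rw [hD.eq_add_sum_coord hv x]
  congr 1
  refine (Finset.sum_subset hS fun e he heS => ?_).symm
  rw [hx.2 e ((hD.mem_edgeFinset hv).1 he) heS, zero_smul]

lemma linearIndependent_edgeVec (hD : IsDelzant P) (hv : v ∈ vertices P)
    {S : Finset (Set (Fin n → ℝ))} (hS : S ⊆ edgeFinset P v) :
    LinearIndependent ℝ (fun e : S => toReal (hD.edgeVec v e)) := by
  classical
  rw [Fintype.linearIndependent_iff]
  intro c hc f
  have h1 := congrArg (fun x => x ⬝ᵥ toReal (hD.dualVec v f)) hc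
  rw [sum_dotProduct, zero_dotProduct, Finset.sum_eq_single f] at h1
  · rw [smul_dotProduct, hD.toReal_edgeVec_dotProduct_dualVec hv
      ((hD.mem_edgeFinset hv).1 (hS f.2)) ((hD.mem_edgeFinset hv).1 (hS f.2))] at h1
    simpa using h1
  · intro e _ hef
    rw [smul_dotProduct, hD.toReal_edgeVec_dotProduct_dualVec hv
      ((hD.mem_edgeFinset hv).1 (hS e.2)) ((hD.mem_edgeFinset hv).1 (hS f.2)),
      if_neg (fun h => hef (Subtype.ext h)), smul_zero]
  · exact fun h => absurd (Finset.mem_univ _) h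

lemma dim_coordFace (hD : IsDelzant P) (hv : v ∈ vertices P)
    {S : Finset (Set (Fin n → ℝ))} (hS : S ⊆ edgeFinset P v) :
    dim (hD.coordFace v S) = S.card := by
  have hspan : vectorSpan ℝ (hD.coordFace v S) =
      Submodule.span ℝ (Set.range fun e : S => toReal (hD.edgeVec v e)) := by
    apply le_antisymm
    · have hmem : ∀ x ∈ hD.coordFace v S,
          x - v ∈ Submodule.span ℝ (Set.range fun e : S => toReal (hD.edgeVec v e)) := by
        intro x hx
        have h1 := hD.eq_add_sum_of_mem_coordFace hv hS hx
        rw [h1, add_sub_cancel_left]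
        exact Submodule.sum_mem _ fun e he => Submodule.smul_mem _ _
          (Submodule.subset_span ⟨⟨e, he⟩, rfl⟩)
      rw [vectorSpan, Submodule.span_le]
      rintro _ ⟨x, hx, y, hy, rfl⟩
      have := Submodule.sub_mem _ (hmem x hx) (hmem y hy)
      simpa using this
    · rw [Submodule.span_le]
      rintro _ ⟨⟨e, heS⟩, rfl⟩
      have he := (hD.mem_edgeFinset hv).1 (hS heS)
      obtain ⟨x, hx, hpos⟩ := hD.exists_coord_pos hv he
      have h1 := vsub_mem_vectorSpan ℝ (hD.edge_subset_coordFace hv he heS hx)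
        (hD.self_mem_coordFace hv S)
      have h2 := Submodule.smul_mem _ (hD.coord v e x)⁻¹ h1
      rw [vsub_eq_sub] at h2
      nth_rewrite 2 [(hD.coord_of_mem_edge hv he hx).2] at h2
      rw [add_sub_cancel_left, inv_smul_smul₀ hpos.ne'] at h2
      exact h2
  rw [dim_eq, hspan, finrank_span_eq_card (hD.linearIndependent_edgeVec hv hS),
    Fintype.card_coe]

/-- Minus the sum of the coordinates outside S is maximal on P exactly where all of them vanish. -/
lemma coordFace_mem_faces (hD : IsDelzant P) (hv : v ∈ vertices P)
    {S : Finset (Set (Fin n → ℝ))} (hS : S ⊆ edgeFinset P v) :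
    hD.coordFace v S ∈ faces P S.card := by
  classical
  refine ⟨fun _ => ⟨dotFunctional (-∑ e ∈ edgeFinset P v \ S, toReal (hD.dualVec v e)), ?_⟩,
    ⟨v, hD.self_mem_coordFace hv S⟩, hD.dim_coordFace hv hS⟩
  have hval : ∀ x, dotFunctional (-∑ e ∈ edgeFinset P v \ S, toReal (hD.dualVec v e)) x =
      dotFunctional (-∑ e ∈ edgeFinset P v \ S, toReal (hD.dualVec v e)) v
        - ∑ e ∈ edgeFinset P v \ S, hD.coord v e x := by
    intro x
    simp only [dotFunctional_apply, dotProduct_neg, dotProduct_sum, coord, sub_dotProduct,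
      Finset.sum_sub_distrib]
    ring
  have hnn : ∀ x ∈ P, ∀ e ∈ edgeFinset P v \ S, 0 ≤ hD.coord v e x := fun x hx e he =>
    hD.coord_nonneg hv ((hD.mem_edgeFinset hv).1 (Finset.mem_sdiff.1 he).1) hx
  ext x
  constructor
  · rintro ⟨hx, h⟩
    refine ⟨hx, fun y hy => ?_⟩
    rw [hval x, hval y, Finset.sum_eq_zero (f := fun e => hD.coord v e x)]
    · linarith [Finset.sum_nonneg (hnn y hy)]
    · intro e he
      obtain ⟨he1, he2⟩ := Finset.mem_sdiff.1 he
      exact h e ((hD.mem_edgeFinset hv).1 he1) he2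
  · rintro ⟨hx, h⟩
    refine ⟨hx, fun e he heS => ?_⟩
    have h1 := h v (mem_of_vertex hv)
    rw [hval x] at h1
    have h2 : ∑ e ∈ edgeFinset P v \ S, hD.coord v e x = 0 :=
      le_antisymm (by linarith) (Finset.sum_nonneg (hnn x hx))
    exact (Finset.sum_eq_zero_iff_of_nonneg (hnn x hx)).1 h2 e
      (Finset.mem_sdiff.2 ⟨(hD.mem_edgeFinset hv).2 he, heS⟩)

/-- A functional maximal at v is nonpositive on every edge vector there; S collects the edges on
which it vanishes. -/
lemma exists_eq_coordFace (hD : IsDelzant P) (hv : v ∈ vertices P) {F : Set (Fin n → ℝ)} {i : ℕ}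
    (hF : F ∈ faces P i) (hvF : v ∈ F) :
    ∃ S ⊆ edgeFinset P v, F = hD.coordFace v S ∧ S.card = i := by
  classical
  obtain ⟨l, hl⟩ := hF.1 ⟨v, hvF⟩
  have hmax : ∀ y ∈ P, l y ≤ l v := by
    rw [hl] at hvF
    exact hvF.2
  have hle : ∀ e ∈ edgesAt P v, l (toReal (hD.edgeVec v e)) ≤ 0 := by
    intro e he
    obtain ⟨x, hx, hpos⟩ := hD.exists_coord_pos hv he
    have h1 := hmax x (mem_of_mem_edge he hx)
    rw [(hD.coord_of_mem_edge hv he hx).2, map_add, map_smul, smul_eq_mul] at h1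
    by_contra! hcon
    have := mul_pos hpos hcon
    linarith
  let S := (edgeFinset P v).filter fun e => l (toReal (hD.edgeVec v e)) = 0
  have hS : S ⊆ edgeFinset P v := Finset.filter_subset _ _
  have hFS : F = hD.coordFace v S := by
    have hval : ∀ x, l x = l v + ∑ e ∈ edgeFinset P v,
        hD.coord v e x * l (toReal (hD.edgeVec v e)) := by
      intro x
      conv_lhs => rw [hD.eq_add_sum_coord hv x]
      simp only [map_add, map_sum, map_smul, smul_eq_mul]
    have hterm : ∀ x ∈ P, ∀ e ∈ edgeFinset P v,
        hD.coord v e x * l (toReal (hD.edgeVec v e)) ≤ 0 := by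
      intro x hx e he
      rw [hD.mem_edgeFinset hv] at he
      exact mul_nonpos_of_nonneg_of_nonpos (hD.coord_nonneg hv he hx) (hle e he)
    rw [hl]
    ext x
    constructor
    · rintro ⟨hx, h⟩
      refine ⟨hx, fun e he heS => ?_⟩
      have h1 := h v (mem_of_vertex hv)
      rw [hval x] at h1
      have h2 := le_antisymm (Finset.sum_nonpos (hterm x hx)) (by linarith)
      have he' := (hD.mem_edgeFinset hv).2 he
      have h3 := (Finset.sum_eq_zero_iff_of_nonpos (hterm x hx)).1 h2 e he'
      exact (mul_eq_zero.1 h3).resolve_right fun h0 => heS (Finset.mem_filter.2 ⟨he', h0⟩)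
    · rintro ⟨hx, h⟩
      refine ⟨hx, fun y hy => ?_⟩
      have : l x = l v := by
        rw [hval x, Finset.sum_eq_zero, add_zero]
        intro e he
        by_cases heS : e ∈ S
        · rw [(Finset.mem_filter.1 heS).2, mul_zero]
        · rw [h e ((hD.mem_edgeFinset hv).1 he) heS, zero_mul]
      rw [this]
      exact hmax y hy
  refine ⟨S, hS, hFS, ?_⟩
  rw [← hD.dim_coordFace hv hS, ← hFS]
  exact hF.2.2

end IsDelzant
end DelzantReflexive

/-! ### Passing along an edge, and relative lengths. -/

namespace DelzantReflexive
namespace IsDelzant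

variable {n : ℕ} {P : Set (Fin n → ℝ)} {v : Fin n → ℝ} {e f : Set (Fin n → ℝ)}

/-- The far end is the unique maximizer of the coordinate along e, hence exposed in e and extreme in
P. -/
lemma exists_other (hD : IsDelzant P) (hv : v ∈ vertices P) (he : e ∈ edgesAt P v) :
    ∃ u ∈ vertices P, 0 < hD.coord v e u ∧ e = segment ℝ v u := by
  have hcompact : IsCompact e := he.1.1.isCompact hD.polytope.isCompact
  have hconv : Convex ℝ e := he.1.1.convex hD.polytope.convex
  let l := dotFunctional (toReal (hD.dualVec v e))
  have hl : ∀ x, hD.coord v e x = l x - l v := by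
    intro x
    simp only [l, dotFunctional_apply, coord, sub_dotProduct]
  obtain ⟨u, hu, hmax⟩ := hcompact.exists_isMaxOn ⟨v, he.2⟩ l.continuous.continuousOn
  have hle : ∀ x ∈ e, hD.coord v e x ≤ hD.coord v e u := by
    intro x hx
    rw [hl, hl]
    have : l x ≤ l u := hmax hx
    linarith
  have hpos : 0 < hD.coord v e u := by
    obtain ⟨x, hx, h⟩ := hD.exists_coord_pos hv he
    exact h.trans_le (hle x hx)
  have huniq : IsExposed ℝ e {u} := by
    refine fun _ => ⟨l, ?_⟩
    ext x
    constructor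
    · rintro rfl
      exact ⟨hu, fun y hy => hmax hy⟩
    · rintro ⟨hx, h⟩
      have h1 : hD.coord v e x = hD.coord v e u := by
        refine le_antisymm (hle x hx) ?_
        rw [hl, hl]
        linarith [h u hu]
      have h2 := (hD.coord_of_mem_edge hv he hx).2
      rw [h1] at h2
      exact h2.trans (hD.coord_of_mem_edge hv he hu).2.symm
  refine ⟨u, ?_, hpos, ?_⟩
  · rw [hD.polytope.vertices_eq]
    exact isExtreme_singleton.1 (he.1.1.isExtreme.trans huniq.isExtreme)
  · apply Set.Subset.antisymm
    · intro x hx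
      obtain ⟨h0, h1⟩ := hD.coord_of_mem_edge hv he hx
      have h2 := (hD.coord_of_mem_edge hv he hu).2
      rw [segment_eq_image']
      refine ⟨hD.coord v e x / hD.coord v e u, ⟨by positivity, (div_le_one hpos).2 (hle x hx)⟩, ?_⟩
      have h3 : u - v = hD.coord v e u • toReal (hD.edgeVec v e) := by
        nth_rewrite 1 [h2]
        rw [add_sub_cancel_left]
      dsimp only
      rw [h3, smul_smul, div_mul_cancel₀ _ hpos.ne']
      exact h1.symm
    · exact hconv.segment_subset he.2 hu

/-- The second vertex of the edge `e` at `v`. -/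
noncomputable def other (hD : IsDelzant P) (v : Fin n → ℝ) (e : Set (Fin n → ℝ)) : Fin n → ℝ :=
  open Classical in
  if h : v ∈ vertices P ∧ e ∈ edgesAt P v then (hD.exists_other h.1 h.2).choose else 0

lemma other_spec (hD : IsDelzant P) (hv : v ∈ vertices P) (he : e ∈ edgesAt P v) :
    hD.other v e ∈ vertices P ∧ 0 < hD.coord v e (hD.other v e) ∧
      e = segment ℝ v (hD.other v e) := by
  rw [other, dif_pos ⟨hv, he⟩]
  exact (hD.exists_other hv he).choose_spec

lemma other_mem_edge (hD : IsDelzant P) (hv : v ∈ vertices P) (he : e ∈ edgesAt P v) :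
    hD.other v e ∈ e := by
  have h := (hD.other_spec hv he).2.2
  have h1 := right_mem_segment ℝ v (hD.other v e)
  rwa [← h] at h1

lemma mem_edgesAt_other (hD : IsDelzant P) (hv : v ∈ vertices P) (he : e ∈ edgesAt P v) :
    e ∈ edgesAt P (hD.other v e) :=
  ⟨he.1, hD.other_mem_edge hv he⟩

lemma other_ne (hD : IsDelzant P) (hv : v ∈ vertices P) (he : e ∈ edgesAt P v) :
    hD.other v e ≠ v := by
  intro h
  have := (hD.other_spec hv he).2.1
  rw [h, coord_self] at this
  exact lt_irrefl _ this

lemma eq_or_eq_of_mem_segment (hD : IsDelzant P) (hv : v ∈ vertices P) {x y : Fin n → ℝ}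
    (hx : x ∈ P) (hy : y ∈ P) (h : v ∈ segment ℝ x y) : x = v ∨ y = v := by
  rw [hD.polytope.vertices_eq] at hv
  exact (mem_extremePoints_iff_forall_segment.1 hv).2 x hx y hy h

lemma eq_or_eq_other (hD : IsDelzant P) (hv : v ∈ vertices P) (he : e ∈ edgesAt P v)
    {u : Fin n → ℝ} (hu : u ∈ vertices P) (hue : u ∈ e) : u = v ∨ u = hD.other v e := by
  obtain ⟨h1, _, h2⟩ := hD.other_spec hv he
  rw [h2] at hue
  rcases hD.eq_or_eq_of_mem_segment hu (mem_of_vertex hv) (mem_of_vertex h1) hue with h | h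
  · exact Or.inl h.symm
  · exact Or.inr h.symm

lemma other_other (hD : IsDelzant P) (hv : v ∈ vertices P) (he : e ∈ edgesAt P v) :
    hD.other (hD.other v e) e = v := by
  have hv' := (hD.other_spec hv he).1
  have he' := hD.mem_edgesAt_other hv he
  rcases hD.eq_or_eq_other hv' he' hv he.2 with h | h
  · exact absurd h.symm (hD.other_ne hv he)
  · exact h.symm

lemma other_eq (hD : IsDelzant P) (hv : v ∈ vertices P) (he : e ∈ edgesAt P v) :
    hD.other v e = v + hD.coord v e (hD.other v e) • toReal (hD.edgeVec v e) :=
  (hD.coord_of_mem_edge hv he (hD.other_mem_edge hv he)).2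

/-- Pairing the relation between the two parallel vectors with both dual vectors gives integers with
c c' = 1; positivity of both lengths selects c = -1. -/
lemma edgeVec_other (hD : IsDelzant P) (hv : v ∈ vertices P) (he : e ∈ edgesAt P v) :
    hD.edgeVec (hD.other v e) e = - hD.edgeVec v e := by
  classical
  have hv' := (hD.other_spec hv he).1
  have he' := hD.mem_edgesAt_other hv he
  have hT := (hD.other_spec hv he).2.1
  have h1 := hD.other_eq hv he
  have hT' := (hD.other_spec hv' he').2.1
  have h2 := hD.other_eq hv' he'
  rw [hD.other_other hv he] at hT' h2
  set u := hD.other v e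
  set T := hD.coord v e u
  set T' := hD.coord u e v
  have h3 : T • toReal (hD.edgeVec v e) + T' • toReal (hD.edgeVec u e) = 0 := by
    funext i
    have h4 := congrFun h1 i
    have h5 := congrFun h2 i
    simp only [Pi.add_apply, Pi.smul_apply, smul_eq_mul, Pi.zero_apply] at h4 h5 ⊢
    linarith
  have h4 := congrArg (fun x => x ⬝ᵥ toReal (hD.dualVec v e)) h3
  have h5 := congrArg (fun x => x ⬝ᵥ toReal (hD.dualVec u e)) h3
  simp only [add_dotProduct, smul_dotProduct, zero_dotProduct,
    hD.toReal_edgeVec_dotProduct_dualVec hv he he,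
    hD.toReal_edgeVec_dotProduct_dualVec hv' he' he', toReal_dotProduct, smul_eq_mul,
    if_true, mul_one] at h4 h5
  set c := hD.edgeVec u e ⬝ᵥ hD.dualVec v e
  set c' := hD.edgeVec v e ⬝ᵥ hD.dualVec u e
  have h6 : c * c' = 1 := by
    have h7 : T * ((c : ℝ) * c' - 1) = 0 := by linear_combination (c : ℝ) * h5 - h4
    have h8 := (mul_eq_zero.1 h7).resolve_left hT.ne'
    have h9 : ((c * c' : ℤ) : ℝ) = ((1 : ℤ) : ℝ) := by
      push_cast
      linarith
    exact_mod_cast h9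
  have h7 : c = -1 := by
    rcases Int.eq_one_or_neg_one_of_mul_eq_one h6 with h | h
    · rw [h] at h4
      push_cast at h4
      linarith
    · exact h
  rw [h7] at h4
  have h8 : T' = T := by
    push_cast at h4
    linarith
  rw [h8, ← smul_add] at h3
  have h9 := (smul_eq_zero.1 h3).resolve_left hT.ne'
  apply toReal_injective
  rw [toReal_neg]
  exact eq_neg_of_add_eq_zero_right h9

/-- The 2-face spanned by e and f at v is spanned at the other end by e and some g. The vector of g
is then a combination of those of e and f; its f-coefficient is nonnegative because P lies in the
orthant at v, and divides 1 by pairing with the dual vector of g. -/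
lemma exists_transport (hD : IsDelzant P) (hv : v ∈ vertices P) (he : e ∈ edgesAt P v)
    (hf : f ∈ edgesAt P v) (hfe : f ≠ e) :
    ∃ g ∈ edgesAt P (hD.other v e), g ≠ e ∧
      ∃ a : ℤ, hD.edgeVec (hD.other v e) g = hD.edgeVec v f - a • hD.edgeVec v e := by
  classical
  have hv' := (hD.other_spec hv he).1
  have he' := hD.mem_edgesAt_other hv he
  have hother := hD.other_mem_edge hv he
  have hW := hD.edgeVec_other hv he
  set u := hD.other v e
  have hS : ({e, f} : Finset (Set (Fin n → ℝ))) ⊆ edgeFinset P v := by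
    intro x hx
    rw [hD.mem_edgeFinset hv]
    rcases Finset.mem_insert.1 hx with rfl | hx
    · exact he
    · rw [Finset.mem_singleton.1 hx]
      exact hf
  have hF := hD.coordFace_mem_faces hv hS
  rw [Finset.card_pair (Ne.symm hfe)] at hF
  have heF : e ⊆ hD.coordFace v {e, f} :=
    hD.edge_subset_coordFace hv he (Finset.mem_insert_self _ _)
  obtain ⟨S', hS', hFS', hcard⟩ := hD.exists_eq_coordFace hv' hF (heF hother)
  have heS' : e ∈ S' := hD.mem_of_edge_subset_coordFace hv' he' (hFS' ▸ heF)
  obtain ⟨g, hgS', hge⟩ := Finset.exists_mem_ne (s := S') (by omega) e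
  have hg := (hD.mem_edgeFinset hv').1 (hS' hgS')
  obtain ⟨x, hx, hpos⟩ := hD.exists_coord_pos hv' hg
  have hxF : x ∈ hD.coordFace v {e, f} := by
    rw [hFS']
    exact hD.edge_subset_coordFace hv' hg hgS' hx
  have hxu := (hD.coord_of_mem_edge hv' hg hx).2
  have hcoord : ∀ h ∈ edgesAt P v, h ≠ e → hD.coord v h x =
      hD.coord u g x * ((hD.edgeVec u g ⬝ᵥ hD.dualVec v h : ℤ) : ℝ) := by
    intro h hh hhe
    have h1 := hD.coord_of_mem_other_edge hv he hh hhe hother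
    conv_lhs => rw [hxu]
    rw [coord_add_smul, h1, toReal_dotProduct, zero_add]
  have hzero : ∀ h ∈ edgesAt P v, h ≠ e → h ≠ f → hD.edgeVec u g ⬝ᵥ hD.dualVec v h = 0 := by
    intro h hh hhe hhf
    have h1 := hxF.2 h hh (by simp [hhe, hhf])
    rw [hcoord h hh hhe] at h1
    exact_mod_cast (mul_eq_zero.1 h1).resolve_left hpos.ne'
  have hnn : 0 ≤ hD.edgeVec u g ⬝ᵥ hD.dualVec v f := by
    have h1 := hD.coord_nonneg hv hf hxF.1
    rw [hcoord f hf hfe] at h1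
    exact_mod_cast nonneg_of_mul_nonneg_right h1 hpos
  have hexp : hD.edgeVec u g = (hD.edgeVec u g ⬝ᵥ hD.dualVec v e) • hD.edgeVec v e +
      (hD.edgeVec u g ⬝ᵥ hD.dualVec v f) • hD.edgeVec v f := by
    conv_lhs => rw [← hD.sum_smul_edgeVec hv (hD.edgeVec u g)]
    rw [← Finset.sum_subset hS, Finset.sum_pair (Ne.symm hfe)]
    intro h hh hhS
    rw [Finset.mem_insert, Finset.mem_singleton, not_or] at hhS
    rw [hzero h ((hD.mem_edgeFinset hv).1 hh) hhS.1 hhS.2, zero_smul]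
  have hone : hD.edgeVec u g ⬝ᵥ hD.dualVec v f = 1 := by
    have h1 := hD.edgeVec_dotProduct_dualVec hv' hg hg
    have h2 := hD.edgeVec_dotProduct_dualVec hv' he' hg
    rw [if_pos rfl, hexp, add_dotProduct, smul_dotProduct, smul_dotProduct] at h1
    rw [if_neg (Ne.symm hge), hW, neg_dotProduct, neg_eq_zero] at h2
    rw [h2, smul_zero, zero_add, smul_eq_mul] at h1
    exact Int.eq_one_of_mul_eq_one_right hnn h1
  refine ⟨g, hg, hge, -(hD.edgeVec u g ⬝ᵥ hD.dualVec v e), ?_⟩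
  rw [hone, one_smul] at hexp
  nth_rewrite 1 [hexp]
  rw [neg_smul, sub_neg_eq_add, add_comm]

/-- The vertices as a finite set. -/
noncomputable def vertexFinset (hD : IsDelzant P) : Finset (Fin n → ℝ) :=
  hD.polytope.finite_extremePoints.toFinset

lemma mem_vertexFinset (hD : IsDelzant P) : v ∈ hD.vertexFinset ↔ v ∈ vertices P := by
  rw [vertexFinset, Set.Finite.mem_toFinset, hD.polytope.vertices_eq]

/-- The edge graph of a Delzant polytope. -/
noncomputable def graph [DecidableEq (Set (Fin n → ℝ))] (hD : IsDelzant P) :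
    LatticeGraph n (Fin n → ℝ) (Set (Fin n → ℝ)) where
  V := hD.vertexFinset
  E := edgeFinset P
  other := hD.other
  W := hD.edgeVec
  D := hD.dualVec
  other_mem {v e} hv he := by
    rw [mem_vertexFinset] at hv ⊢
    exact (hD.other_spec hv ((hD.mem_edgeFinset hv).1 he)).1
  mem_other {v e} hv he := by
    rw [mem_vertexFinset] at hv
    rw [hD.mem_edgeFinset hv] at he
    exact (hD.mem_edgeFinset (hD.other_spec hv he).1).2 (hD.mem_edgesAt_other hv he)
  other_other {v e} hv he := by
    rw [mem_vertexFinset] at hv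
    exact hD.other_other hv ((hD.mem_edgeFinset hv).1 he)
  W_other {v e} hv he := by
    rw [mem_vertexFinset] at hv
    exact hD.edgeVec_other hv ((hD.mem_edgeFinset hv).1 he)
  dual {v e f} hv he hf := by
    rw [mem_vertexFinset] at hv
    exact hD.edgeVec_dotProduct_dualVec hv ((hD.mem_edgeFinset hv).1 he)
      ((hD.mem_edgeFinset hv).1 hf)
  exists_transport {v e f} hv he hf hfe := by
    rw [mem_vertexFinset] at hv
    rw [hD.mem_edgeFinset hv] at he hf
    obtain ⟨g, hg, h⟩ := hD.exists_transport hv he hf hfe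
    exact ⟨g, (hD.mem_edgeFinset (hD.other_spec hv he).1).2 hg, h⟩

lemma isPrimitive_edgeVec (hD : IsDelzant P) (hv : v ∈ vertices P) (he : e ∈ edgesAt P v) :
    IsPrimitive (hD.edgeVec v e) := by
  classical
  intro m u h
  have h1 := hD.edgeVec_dotProduct_dualVec hv he he
  rw [if_pos rfl, h, smul_dotProduct, smul_eq_mul] at h1
  exact Int.eq_one_or_neg_one_of_mul_eq_one h1

/-- The length is an arbitrary choice by definition, so uniqueness is needed: the endpoints of the
segment are the two vertices up to order, and primitivity makes the direction ± the edge vector. -/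
lemma relLength_eq (hD : IsDelzant P) (hv : v ∈ vertices P) (he : e ∈ edgesAt P v) :
    relLength e = hD.coord v e (hD.other v e) := by
  classical
  obtain ⟨hv', hT, hseg⟩ := hD.other_spec hv he
  have hother := hD.other_eq hv he
  have hne := hD.other_ne hv he
  have hsub : segment ℝ v (hD.other v e) ⊆ P := hseg ▸ he.1.1.subset
  set u := hD.other v e
  set T := hD.coord v e u
  have hex : HasRelLength e T :=
    ⟨hT, v, u, hD.edgeVec v e, hseg, hD.isPrimitive_edgeVec hv he, by
      nth_rewrite 1 [hother]
      rw [add_sub_cancel_left]⟩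
  obtain ⟨hr, v₁, v₂, w, hseg', hw, hdiff⟩ : HasRelLength e (relLength e) :=
    Classical.epsilon_spec ⟨T, hex⟩
  set r := relLength e
  have h1 : v₁ ∈ P := hsub (by rw [← hseg, hseg']; exact left_mem_segment ℝ _ _)
  have h2 : v₂ ∈ P := hsub (by rw [← hseg, hseg']; exact right_mem_segment ℝ _ _)
  have h3 := hD.eq_or_eq_of_mem_segment hv h1 h2
    (by rw [← hseg', hseg]; exact left_mem_segment ℝ _ _)
  have h4 := hD.eq_or_eq_of_mem_segment hv' h1 h2
    (by rw [← hseg', hseg]; exact right_mem_segment ℝ _ _)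
  have hTe : u - v = T • toReal (hD.edgeVec v e) := by
    nth_rewrite 1 [hother]
    rw [add_sub_cancel_left]
  obtain ⟨s, hs, hsw⟩ : ∃ s : ℝ, (s = T ∨ s = -T) ∧ r • toReal w = s • toReal (hD.edgeVec v e) := by
    rcases h3 with h3 | h3 <;> rcases h4 with h4 | h4
    · exact absurd (h4.symm.trans h3) hne
    · exact ⟨T, Or.inl rfl, by rw [← hdiff, ← hTe, h3, h4]⟩
    · exact ⟨-T, Or.inr rfl, by rw [← hdiff, neg_smul, ← hTe, h3, h4, neg_sub]⟩
    · exact absurd (h4.symm.trans h3) hne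
  have h5 := congrArg (fun x => x ⬝ᵥ toReal (hD.dualVec v e)) hsw
  simp only [smul_dotProduct, hD.toReal_edgeVec_dotProduct_dualVec hv he he, toReal_dotProduct,
    smul_eq_mul, if_true, mul_one] at h5
  set c := w ⬝ᵥ hD.dualVec v e
  have h6 : w = c • hD.edgeVec v e := by
    apply toReal_injective
    rw [toReal_smul]
    have h7 : r • toReal w = r • ((c : ℝ) • toReal (hD.edgeVec v e)) := by
      rw [hsw, smul_smul, h5]
    exact smul_right_injective _ hr.ne' h7
  rcases hw c _ h6 with h | h <;> rw [h] at h5 <;> push_cast at h5 <;>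
    rcases hs with hs | hs <;> linarith

lemma other_sub (hD : IsDelzant P) (hv : v ∈ vertices P) (he : e ∈ edgesAt P v) :
    hD.other v e - v = relLength e • toReal (hD.edgeVec v e) := by
  rw [hD.relLength_eq hv he]
  nth_rewrite 1 [hD.other_eq hv he]
  rw [add_sub_cancel_left]

lemma exists_relLength_eq_natCast (hD : IsDelzant P) (hI : IsIntegral P) (hv : v ∈ vertices P)
    (he : e ∈ edgesAt P v) : ∃ q : ℕ, 0 < q ∧ relLength e = q := by
  obtain ⟨hv', hT, -⟩ := hD.other_spec hv he
  rw [hD.relLength_eq hv he]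
  obtain ⟨a, ha⟩ := hI _ hv
  obtain ⟨b, hb⟩ := hI _ hv'
  have h1 : hD.coord v e (hD.other v e) = (((b - a) ⬝ᵥ hD.dualVec v e : ℤ) : ℝ) := by
    rw [coord, hb, ha, ← toReal_sub, toReal_dotProduct]
  rw [h1] at hT ⊢
  have hpos : 0 < (b - a) ⬝ᵥ hD.dualVec v e := by exact_mod_cast hT
  refine ⟨((b - a) ⬝ᵥ hD.dualVec v e).toNat, by omega, ?_⟩
  exact_mod_cast (Int.toNat_of_nonneg hpos.le).symm

end IsDelzant
end DelzantReflexive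

/-! ### Reflexivity, face counting by a generic functional, and the sum of the lengths. -/

namespace DelzantReflexive
namespace IsDelzant

variable {n : ℕ} {P : Set (Fin n → ℝ)} {v : Fin n → ℝ} {e f : Set (Fin n → ℝ)}

/-- A new edge is added by taking the midpoint of two points of P reached with parameter 2t, hence
the halved bound. -/
lemma exists_add_smul_sum_mem (hD : IsDelzant P) (hv : v ∈ vertices P)
    (S : Finset (Set (Fin n → ℝ))) (hS : ∀ e ∈ S, e ∈ edgesAt P v) :
    ∃ δ : ℝ, 0 < δ ∧ ∀ t : ℝ, 0 ≤ t → t ≤ δ → v + t • ∑ e ∈ S, toReal (hD.edgeVec v e) ∈ P := by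
  classical
  have hvP := mem_of_vertex hv
  induction S using Finset.induction_on with
  | empty => exact ⟨1, one_pos, fun t _ _ => by simpa using hvP⟩
  | insert a S ha ih =>
    obtain ⟨δ, hδ, h⟩ := ih fun e he => hS e (Finset.mem_insert_of_mem he)
    have haE := hS a (Finset.mem_insert_self _ _)
    obtain ⟨x, hx, hpos⟩ := hD.exists_coord_pos hv haE
    have hxP := mem_of_mem_edge haE hx
    have hxe := (hD.coord_of_mem_edge hv haE hx).2
    set T := hD.coord v a x
    refine ⟨min δ T / 2, by positivity, fun t ht0 ht => ?_⟩
    have ht1 : 2 * t ≤ δ := by linarith [min_le_left δ T]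
    have ht2 : 2 * t ≤ T := by linarith [min_le_right δ T]
    have h1 := h (2 * t) (by linarith) ht1
    have h2 : v + (2 * t) • toReal (hD.edgeVec v a) ∈ P := by
      have h3 := hD.polytope.convex.add_smul_sub_mem hvP hxP
        (t := 2 * t / T) ⟨by positivity, (div_le_one hpos).2 ht2⟩
      have h4 : x - v = T • toReal (hD.edgeVec v a) := by
        nth_rewrite 1 [hxe]
        rw [add_sub_cancel_left]
      rwa [h4, smul_smul, div_mul_cancel₀ _ hpos.ne'] at h3
    have h5 := hD.polytope.convex h1 h2 (a := 1 / 2) (b := 1 / 2) (by norm_num) (by norm_num)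
      (by norm_num)
    rw [Finset.sum_insert ha]
    convert h5 using 1
    module

/-- At a vertex of a reflexive Delzant polytope all the coordinates are `-1`. -/
lemma dotProduct_dualVec_eq_neg_one (hD : IsDelzant P) (hR : IsReflexive P)
    (hv : v ∈ vertices P) (hf : f ∈ edgesAt P v) : v ⬝ᵥ toReal (hD.dualVec v f) = -1 := by
  classical
  obtain ⟨z, hz⟩ := hR.integral v hv
  have hEm : ∀ e ∈ (edgeFinset P v).erase f, e ∈ edgesAt P v := fun e he =>
    (hD.mem_edgeFinset hv).1 (Finset.mem_of_mem_erase he)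
  obtain ⟨δ', hδ', hδP⟩ := hD.exists_add_smul_sum_mem hv ((edgeFinset P v).erase f) hEm
  set u : Fin n → ℤ := ∑ e ∈ (edgeFinset P v).erase f, hD.edgeVec v e with hu
  have huR : toReal u = ∑ e ∈ (edgeFinset P v).erase f, toReal (hD.edgeVec v e) := by
    funext i
    simp [hu, toReal, Finset.sum_apply]
  rw [← huR] at hδP
  obtain ⟨δ, hδ, hδδ⟩ : ∃ δ : ℝ, 0 < δ ∧ δ' = 2 * δ := ⟨δ' / 2, by positivity, by ring⟩
  obtain ⟨r, hr, hrP⟩ : ∃ r : ℝ, 0 < r ∧ r • (-toReal (hD.edgeVec v f)) ∈ P := by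
    have hcont : Filter.Tendsto (fun r : ℝ => r • (-toReal (hD.edgeVec v f))) (nhds 0)
        (nhds 0) := by
      have : Continuous fun r : ℝ => r • (-toReal (hD.edgeVec v f)) := by fun_prop
      simpa using this.tendsto 0
    have hev := hcont.eventually (mem_interior_iff_mem_nhds.1 hR.zero_mem_interior)
    obtain ⟨ε, hε, h⟩ := Metric.eventually_nhds_iff.1 hev
    refine ⟨ε / 2, by positivity, h ?_⟩
    rw [Real.dist_eq, sub_zero, abs_of_pos (by positivity)]
    linarith
  have hle : ∀ l ∈ facetNormals P, ∀ x ∈ P, x ⬝ᵥ toReal l ≤ 1 := by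
    intro l hl x hx
    rw [hR.eq_inter] at hx
    exact Set.mem_iInter₂.1 hx l hl
  -- The point v + δu lies in the facet opposite f; moving it by -rκ w_f leaves P and so violates an
  -- inequality l. As -r w_f ∈ P, this move raises l by at most κ. With the bound at v + 2δu, κ ≤
  -- 1/2 forces ⟨v, l⟩ = 1; then κ ≤ δ forces ⟨u, l⟩ = 0, both by integrality.
  set κ : ℝ := min (1 / 2) δ
  have hκ : 0 < κ := lt_min (by norm_num) hδ
  have hnot : v + δ • toReal u - (r * κ) • toReal (hD.edgeVec v f) ∉ P := by
    intro hmem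
    have h1 := hD.coord_nonneg hv hf hmem
    have h2 : toReal u ⬝ᵥ toReal (hD.dualVec v f) = 0 := by
      rw [huR, sum_dotProduct]
      refine Finset.sum_eq_zero fun e he => ?_
      rw [hD.toReal_edgeVec_dotProduct_dualVec hv (hEm e he) hf,
        if_neg (Finset.ne_of_mem_erase he)]
    rw [sub_eq_add_neg, ← neg_smul, coord_add_smul, coord_add_smul, coord_self, h2,
      hD.toReal_edgeVec_dotProduct_dualVec hv hf hf, if_pos rfl] at h1
    have := mul_pos hr hκ
    linarith
  obtain ⟨l, hl, hlt⟩ : ∃ l ∈ facetNormals P,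
      1 < (v + δ • toReal u - (r * κ) • toReal (hD.edgeVec v f)) ⬝ᵥ toReal l := by
    by_contra! hcon
    exact hnot (hR.eq_inter.symm.subset (Set.mem_iInter₂.2 hcon))
  have hzl : ∀ w, v ⬝ᵥ toReal w = ((z ⬝ᵥ w : ℤ) : ℝ) := fun w => by rw [hz, toReal_dotProduct]
  have hvl := hle l hl v (mem_of_vertex hv)
  have hvul := hle l hl _ (hδP δ hδ.le (by linarith))
  have hvul2 := hle l hl _ (hδP (2 * δ) (by linarith) (by linarith))
  have hrl := hle l hl _ hrP
  simp only [sub_dotProduct, add_dotProduct, smul_dotProduct, neg_dotProduct, hzl,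
    toReal_dotProduct, smul_eq_mul] at hlt hvl hvul hvul2 hrl
  set A := z ⬝ᵥ l
  set B := u ⬝ᵥ l with hB
  set C := hD.edgeVec v f ⬝ᵥ l
  have hC : -(r * κ * (C : ℝ)) ≤ κ := by nlinarith
  have hκ1 : κ ≤ 1 / 2 := min_le_left _ _
  have hκ2 : κ ≤ δ := min_le_right _ _
  have hA : A = 1 := by
    have h1 : A ≤ 1 := by exact_mod_cast hvl
    by_contra hne
    have h2 : A ≤ 0 := by omega
    have h3 : (A : ℝ) ≤ 0 := by exact_mod_cast h2
    linarith
  rw [hA] at hlt hvul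
  push_cast at hlt hvul
  have hB0 : B = 0 := by
    have h1 : (B : ℝ) ≤ 0 := by nlinarith
    have h2 : (-1 : ℝ) < B := by nlinarith
    have h3 : B ≤ 0 := by exact_mod_cast h1
    have h4 : -1 < B := by exact_mod_cast h2
    omega
  have hWle : ∀ e ∈ edgesAt P v, hD.edgeVec v e ⬝ᵥ l ≤ 0 := by
    intro e he
    obtain ⟨x, hx, hpos⟩ := hD.exists_coord_pos hv he
    have h1 := hle l hl x (mem_of_mem_edge he hx)
    rw [(hD.coord_of_mem_edge hv he hx).2, add_dotProduct, smul_dotProduct, hzl,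
      toReal_dotProduct, smul_eq_mul] at h1
    have h2 : ((z ⬝ᵥ l : ℤ) : ℝ) = 1 := by exact_mod_cast hA
    rw [h2] at h1
    have h3 : ((hD.edgeVec v e ⬝ᵥ l : ℤ) : ℝ) ≤ 0 := by
      by_contra! hcon
      have := mul_pos hpos hcon
      linarith
    exact_mod_cast h3
  -- The nonpositive pairings sum to ⟨u, l⟩ = 0, so l sees only w_f, and ⟨v, l⟩ = 1 makes the
  -- f-coordinate of v a unit.
  have hW0 : ∀ e ∈ (edgeFinset P v).erase f, hD.edgeVec v e ⬝ᵥ l = 0 := by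
    rw [hB, hu, sum_dotProduct] at hB0
    exact (Finset.sum_eq_zero_iff_of_nonpos fun e he => hWle e (hEm e he)).1 hB0
  have hk : (z ⬝ᵥ hD.dualVec v f) * C = 1 := by
    have h1 := congrArg (fun x => x ⬝ᵥ l) (hD.sum_smul_edgeVec hv z)
    rw [sum_dotProduct, ← Finset.add_sum_erase _ _ ((hD.mem_edgeFinset hv).2 hf),
      Finset.sum_eq_zero, add_zero, smul_dotProduct, smul_eq_mul] at h1
    · rw [h1]
      exact hA
    · intro e he
      rw [smul_dotProduct, hW0 e he, smul_zero]
  have hCle := hWle f hf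
  rw [hzl]
  rcases Int.eq_one_or_neg_one_of_mul_eq_one hk with h | h
  · rw [h] at hk
    omega
  · rw [h]
    norm_num

/-- The edges at `v` along which `ξ` decreases. -/
noncomputable def down (hD : IsDelzant P) (ξ : Fin n → ℤ) (v : Fin n → ℝ) :
    Finset (Set (Fin n → ℝ)) :=
  (edgeFinset P v).filter fun e => ξ ⬝ᵥ hD.edgeVec v e < 0

/-- `ξ` is not constant along any edge. -/
def IsGeneric (hD : IsDelzant P) (ξ : Fin n → ℤ) : Prop :=
  ∀ v ∈ vertices P, ∀ e ∈ edgesAt P v, ξ ⬝ᵥ hD.edgeVec v e ≠ 0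

lemma exists_isGeneric (hD : IsDelzant P) : ∃ ξ, hD.IsGeneric ξ := by
  classical
  obtain ⟨ξ, hξ⟩ := exists_generic
    (hD.vertexFinset.biUnion fun v => (edgeFinset P v).image fun e => hD.edgeVec v e) (by
      intro u hu h0
      simp only [Finset.mem_biUnion, Finset.mem_image] at hu
      obtain ⟨v, hv, e, he, rfl⟩ := hu
      rw [mem_vertexFinset] at hv
      rw [hD.mem_edgeFinset hv] at he
      have h1 := hD.edgeVec_dotProduct_dualVec hv he he
      rw [h0, zero_dotProduct, if_pos rfl] at h1
      exact zero_ne_one h1)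
  refine ⟨ξ, fun v hv e he => hξ _ ?_⟩
  simp only [Finset.mem_biUnion, Finset.mem_image]
  exact ⟨v, hD.mem_vertexFinset.2 hv, e, (hD.mem_edgeFinset hv).2 he, rfl⟩

lemma down_subset (hD : IsDelzant P) (ξ : Fin n → ℤ) (v : Fin n → ℝ) :
    hD.down ξ v ⊆ edgeFinset P v := Finset.filter_subset _ _

lemma card_down_neg (hD : IsDelzant P) {ξ : Fin n → ℤ} (hξ : hD.IsGeneric ξ)
    (hv : v ∈ vertices P) : (hD.down ξ v).card + (hD.down (-ξ) v).card = n := by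
  have h1 : hD.down (-ξ) v = (edgeFinset P v).filter fun e => ¬ ξ ⬝ᵥ hD.edgeVec v e < 0 := by
    refine Finset.filter_congr fun e he => ?_
    have := hξ v hv e ((hD.mem_edgeFinset hv).1 he)
    rw [neg_dotProduct]
    omega
  rw [h1, down, Finset.card_filter_add_card_filter_not, hD.card_edgeFinset hv]

lemma dotFunctional_toReal_edgeVec (hD : IsDelzant P) (ξ : Fin n → ℤ) :
    dotFunctional (toReal ξ) (toReal (hD.edgeVec v e)) = ((ξ ⬝ᵥ hD.edgeVec v e : ℤ) : ℝ) := by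
  rw [dotFunctional_apply, toReal_dotProduct, dotProduct_comm]

/-- On a face spanned by descending edges, v is the only maximum of ξ. -/
lemma eq_of_mem_coordFace_of_le (hD : IsDelzant P) {ξ : Fin n → ℤ} (hv : v ∈ vertices P)
    {S : Finset (Set (Fin n → ℝ))} (hS : S ⊆ hD.down ξ v) {x : Fin n → ℝ}
    (hx : x ∈ hD.coordFace v S)
    (hle : dotFunctional (toReal ξ) v ≤ dotFunctional (toReal ξ) x) : x = v := by
  have h1 := hD.eq_add_sum_of_mem_coordFace hv (hS.trans (hD.down_subset ξ v)) hx
  have hneg : ∀ e ∈ S, ((ξ ⬝ᵥ hD.edgeVec v e : ℤ) : ℝ) < 0 := fun e he => by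
    exact_mod_cast (Finset.mem_filter.1 (hS he)).2
  have hterm : ∀ e ∈ S, hD.coord v e x * ((ξ ⬝ᵥ hD.edgeVec v e : ℤ) : ℝ) ≤ 0 := fun e he =>
    mul_nonpos_of_nonneg_of_nonpos
      (hD.coord_nonneg hv ((hD.mem_edgeFinset hv).1 (hD.down_subset ξ v (hS he))) hx.1)
      (hneg e he).le
  have h2 := congrArg (dotFunctional (toReal ξ)) h1
  simp only [map_add, map_sum, map_smul, smul_eq_mul, hD.dotFunctional_toReal_edgeVec] at h2
  have h3 := (Finset.sum_eq_zero_iff_of_nonpos hterm).1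
    (le_antisymm (Finset.sum_nonpos hterm) (by linarith))
  rw [h1, Finset.sum_eq_zero, add_zero]
  intro e he
  rw [(mul_eq_zero.1 (h3 e he)).resolve_right (hneg e he).ne, zero_smul]

lemma exists_vertex_isMax (hD : IsDelzant P) {F : Set (Fin n → ℝ)} {i : ℕ} (hF : F ∈ faces P i)
    (l : StrongDual ℝ (Fin n → ℝ)) : ∃ v ∈ vertices P, v ∈ F ∧ ∀ x ∈ F, l x ≤ l v := by
  have hcompact : IsCompact F := hF.1.isCompact hD.polytope.isCompact
  have hexp : IsExposed ℝ F (l.toExposed F) := ContinuousLinearMap.toExposed.isExposed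
  have hne : (l.toExposed F).Nonempty := by
    obtain ⟨u, hu, hmax⟩ := hcompact.exists_isMaxOn hF.2.1 l.continuous.continuousOn
    exact ⟨u, hu, fun y hy => hmax hy⟩
  obtain ⟨v, hv⟩ := (hexp.isCompact hcompact).extremePoints_nonempty hne
  refine ⟨v, ?_, hv.1.1, hv.1.2⟩
  rw [hD.polytope.vertices_eq]
  exact (hF.1.isExtreme.trans hexp.isExtreme).extremePoints_subset_extremePoints hv

/-- At a vertex where ξ is maximal on the face, all edges of the face descend. -/
lemma faces_eq_image (hD : IsDelzant P) {ξ : Fin n → ℤ} (hξ : hD.IsGeneric ξ) (i : ℕ) :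
    faces P i = (fun x : Σ _ : Fin n → ℝ, Finset (Set (Fin n → ℝ)) => hD.coordFace x.1 x.2) ''
      (hD.vertexFinset.sigma fun v => (hD.down ξ v).powersetCard i : Set _) := by
  ext F
  constructor
  · intro hF
    obtain ⟨v, hv, hvF, hmax⟩ := hD.exists_vertex_isMax hF (dotFunctional (toReal ξ))
    obtain ⟨S, hS, rfl, hcard⟩ := hD.exists_eq_coordFace hv hF hvF
    refine ⟨⟨v, S⟩, Finset.mem_coe.2 (Finset.mem_sigma.2 ⟨hD.mem_vertexFinset.2 hv,
      Finset.mem_powersetCard.2 ⟨fun e heS => Finset.mem_filter.2 ⟨hS heS, ?_⟩, hcard⟩⟩), rfl⟩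
    have he := (hD.mem_edgeFinset hv).1 (hS heS)
    obtain ⟨x, hx, hpos⟩ := hD.exists_coord_pos hv he
    have h1 := hmax x (hD.edge_subset_coordFace hv he heS hx)
    rw [(hD.coord_of_mem_edge hv he hx).2, map_add, map_smul, smul_eq_mul,
      hD.dotFunctional_toReal_edgeVec] at h1
    have h2 : ((ξ ⬝ᵥ hD.edgeVec v e : ℤ) : ℝ) ≤ 0 := by
      by_contra! hcon
      have := mul_pos hpos hcon
      linarith
    exact lt_of_le_of_ne (by exact_mod_cast h2) (hξ v hv e he)
  · rintro ⟨⟨v, S⟩, hx, rfl⟩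
    obtain ⟨hv, hS⟩ := Finset.mem_sigma.1 (Finset.mem_coe.1 hx)
    obtain ⟨hS, hcard⟩ := Finset.mem_powersetCard.1 hS
    have := hD.coordFace_mem_faces (hD.mem_vertexFinset.1 hv) (hS.trans (hD.down_subset ξ v))
    rw [hcard] at this
    exact this

lemma finite_faces (hD : IsDelzant P) (i : ℕ) : (faces P i).Finite := by
  obtain ⟨ξ, hξ⟩ := hD.exists_isGeneric
  rw [hD.faces_eq_image hξ]
  exact (Finset.finite_toSet _).image _

/-- The highest vertex of a face is unique and the face determines its spanning edges, so each face
is counted once. -/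
lemma fVec_eq_sum (hD : IsDelzant P) {ξ : Fin n → ℤ} (hξ : hD.IsGeneric ξ) (i : ℕ) :
    fVec P i = ∑ v ∈ hD.vertexFinset, (hD.down ξ v).card.choose i := by
  rw [fVec, hD.faces_eq_image hξ, Set.InjOn.ncard_image, Set.ncard_coe_finset,
    Finset.card_sigma]
  · simp only [Finset.card_powersetCard]
  · rintro ⟨v, S⟩ hx ⟨v', S'⟩ hx' heq
    obtain ⟨hv, hS⟩ := Finset.mem_sigma.1 (Finset.mem_coe.1 hx)
    obtain ⟨hv', hS'⟩ := Finset.mem_sigma.1 (Finset.mem_coe.1 hx')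
    rw [mem_vertexFinset] at hv hv'
    replace hS := (Finset.mem_powersetCard.1 hS).1
    replace hS' := (Finset.mem_powersetCard.1 hS').1
    dsimp only at hv hv' hS hS' heq
    have hv'F : v' ∈ hD.coordFace v S := heq ▸ hD.self_mem_coordFace hv' S'
    have hvF : v ∈ hD.coordFace v' S' := heq ▸ hD.self_mem_coordFace hv S
    have hvv : v' = v := by
      rcases le_total (dotFunctional (toReal ξ) v) (dotFunctional (toReal ξ) v') with h | h
      · exact hD.eq_of_mem_coordFace_of_le hv hS hv'F h
      · exact (hD.eq_of_mem_coordFace_of_le hv' hS' hvF h).symm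
    subst hvv
    congr 1
    have hmem : ∀ T T' : Finset (Set (Fin n → ℝ)), T ⊆ hD.down ξ v' →
        hD.coordFace v' T = hD.coordFace v' T' → T ⊆ T' := by
      intro T T' hT h e he
      have heE := (hD.mem_edgeFinset hv').1 (hD.down_subset ξ v' (hT he))
      exact hD.mem_of_edge_subset_coordFace hv' heE (h ▸ hD.edge_subset_coordFace hv' heE he)
    exact Finset.Subset.antisymm (hmem _ _ hS heq) (hmem _ _ hS' heq.symm)

/-- Each edge has two vertices. -/
lemma sum_vertex_edge (hD : IsDelzant P) (φ : Set (Fin n → ℝ) → ℝ) :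
    ∑ v ∈ hD.vertexFinset, ∑ e ∈ edgeFinset P v, φ e =
      2 * ∑ e ∈ (hD.finite_faces 1).toFinset, φ e := by
  classical
  rw [Finset.sum_comm' (t' := (hD.finite_faces 1).toFinset)
    (s' := fun e => hD.vertexFinset.filter fun v => v ∈ e), Finset.mul_sum]
  · refine Finset.sum_congr rfl fun e he => ?_
    rw [Set.Finite.mem_toFinset] at he
    obtain ⟨v, hv, hve, -⟩ := hD.exists_vertex_isMax he 0
    have heE : e ∈ edgesAt P v := ⟨he, hve⟩
    have h1 : hD.vertexFinset.filter (fun v => v ∈ e) = {v, hD.other v e} := by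
      ext u
      rw [Finset.mem_filter, mem_vertexFinset, Finset.mem_insert, Finset.mem_singleton]
      constructor
      · rintro ⟨hu, hue⟩
        exact hD.eq_or_eq_other hv heE hu hue
      · rintro (rfl | rfl)
        · exact ⟨hv, hve⟩
        · exact ⟨(hD.other_spec hv heE).1, hD.other_mem_edge hv heE⟩
    rw [h1, Finset.sum_pair (Ne.symm (hD.other_ne hv heE))]
    ring
  · intro v e
    rw [Finset.mem_filter, mem_vertexFinset, Set.Finite.mem_toFinset]
    constructor
    · rintro ⟨hv, he⟩
      rw [hD.mem_edgeFinset hv] at he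
      exact ⟨⟨hv, he.2⟩, he.1⟩
    · rintro ⟨⟨hv, hve⟩, he⟩
      exact ⟨hv, (hD.mem_edgeFinset hv).2 ⟨he, hve⟩⟩

/-- This is (Σ s)² - Σ s² for the n signs s = ±1, whose sum is n minus twice the number of negative
ones. -/
lemma sum_sign_pairs (hD : IsDelzant P) {ξ : Fin n → ℤ} (hξ : hD.IsGeneric ξ)
    (hv : v ∈ vertices P) [DecidableEq (Set (Fin n → ℝ))] :
    ∑ e ∈ edgeFinset P v, ∑ f ∈ (edgeFinset P v).erase e,
      ((ξ ⬝ᵥ hD.edgeVec v f).sign : ℚ) * ((ξ ⬝ᵥ hD.edgeVec v e).sign : ℚ) =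
    ((n : ℚ) - 2 * (hD.down ξ v).card) ^ 2 - n := by
  set s : Set (Fin n → ℝ) → ℚ := fun e => ((ξ ⬝ᵥ hD.edgeVec v e).sign : ℚ)
  have hs : ∀ e ∈ edgeFinset P v, s e = 1 - 2 * (if ξ ⬝ᵥ hD.edgeVec v e < 0 then 1 else 0) := by
    intro e he
    have hne := hξ v hv e ((hD.mem_edgeFinset hv).1 he)
    simp only [s]
    split_ifs with h
    · rw [Int.sign_eq_neg_one_of_neg h]
      norm_num
    · rw [Int.sign_eq_one_of_pos (by omega)]
      norm_num
  have hsum : ∑ e ∈ edgeFinset P v, s e = (n : ℚ) - 2 * (hD.down ξ v).card := by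
    rw [Finset.sum_congr rfl hs, Finset.sum_sub_distrib, ← Finset.mul_sum, Finset.sum_boole,
      Finset.sum_const, hD.card_edgeFinset hv, down]
    simp
  have hsq : ∀ e ∈ edgeFinset P v, s e * s e = 1 := by
    intro e he
    rw [hs e he]
    split_ifs <;> norm_num
  have h1 : ∀ e ∈ edgeFinset P v, ∑ f ∈ (edgeFinset P v).erase e, s f * s e =
      (∑ f ∈ edgeFinset P v, s f) * s e - 1 := by
    intro e he
    rw [← Finset.add_sum_erase _ _ he, add_mul, hsq e he, Finset.sum_mul]
    ring
  rw [Finset.sum_congr rfl h1, Finset.sum_sub_distrib, ← Finset.mul_sum, hsum, Finset.sum_const,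
    hD.card_edgeFinset hv]
  simp
  ring

/-- The sum of the relative lengths of the edges of a reflexive Delzant polytope. -/
theorem sum_relLength (hD : IsDelzant P) (hR : IsReflexive P) :
    ∑ e ∈ (hD.finite_faces 1).toFinset, relLength e =
      12 * (fVec P 2 : ℝ) + (5 - 3 * n) * (fVec P 1 : ℝ) := by
  classical
  obtain ⟨ξ, hξ⟩ := hD.exists_isGeneric
  set m : (Fin n → ℝ) → Set (Fin n → ℝ) → ℝ := fun v e => ((ξ ⬝ᵥ hD.edgeVec v e : ℤ) : ℝ) with hm
  set V := hD.vertexFinset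
  have hm0 : ∀ v ∈ V, ∀ e ∈ edgeFinset P v, m v e ≠ 0 := by
    intro v hv e he
    rw [mem_vertexFinset] at hv
    exact Int.cast_ne_zero.2 (hξ v hv e ((hD.mem_edgeFinset hv).1 he))
  have hlen : ∀ v ∈ V, ∀ e ∈ edgeFinset P v, relLength e =
      toReal ξ ⬝ᵥ hD.other v e / m v e - toReal ξ ⬝ᵥ v / m v e := by
    intro v hv e he
    have h0 := hm0 v hv e he
    rw [mem_vertexFinset] at hv
    have h1 := congrArg (fun x => toReal ξ ⬝ᵥ x)
      (hD.other_sub hv ((hD.mem_edgeFinset hv).1 he))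
    simp only [dotProduct_sub, dotProduct_smul, toReal_dotProduct, smul_eq_mul] at h1
    rw [← sub_div, eq_div_iff h0, h1]
  -- Reversing the edge negates its vector, so the far-end terms duplicate the near-end ones.
  have hflag : ∑ v ∈ V, ∑ e ∈ edgeFinset P v, toReal ξ ⬝ᵥ hD.other v e / m v e =
      ∑ v ∈ V, ∑ e ∈ edgeFinset P v, -(toReal ξ ⬝ᵥ v / m v e) := by
    refine LatticeGraph.sum_flag (Γ := hD.graph)
      (fun v e => toReal ξ ⬝ᵥ hD.other v e / m v e) (fun v e => -(toReal ξ ⬝ᵥ v / m v e)) ?_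
    intro v hv e he
    have h1 : m (hD.other v e) e = - m v e := by
      have h2 : hD.edgeVec (hD.other v e) e = - hD.edgeVec v e := hD.graph.W_other hv he
      simp only [hm]
      rw [h2, dotProduct_neg, Int.cast_neg]
    change _ = -(toReal ξ ⬝ᵥ hD.other v e / m (hD.other v e) e)
    rw [h1, div_neg, neg_neg]
  -- Here reflexivity enters, as v = -Σ_f w_f; the term f = e contributes the 1.
  have hvert : ∀ v ∈ V, ∀ e ∈ edgeFinset P v, -(toReal ξ ⬝ᵥ v / m v e) =
      1 + ∑ f ∈ (edgeFinset P v).erase e, m v f / m v e := by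
    intro v hv e he
    have h0 := hm0 v hv e he
    rw [mem_vertexFinset] at hv
    have h1 : toReal ξ ⬝ᵥ v = -∑ f ∈ edgeFinset P v, m v f := by
      conv_lhs => rw [← hD.sum_smul_toReal_edgeVec hv v]
      rw [dotProduct_sum, ← Finset.sum_neg_distrib]
      refine Finset.sum_congr rfl fun f hf => ?_
      rw [dotProduct_smul, toReal_dotProduct,
        hD.dotProduct_dualVec_eq_neg_one hR hv ((hD.mem_edgeFinset hv).1 hf)]
      simp [hm]
    rw [h1, ← Finset.add_sum_erase _ _ he, neg_div, neg_neg, add_div, div_self h0,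
      Finset.sum_div]
  have hratio : ∑ v ∈ V, ∑ e ∈ edgeFinset P v, ∑ f ∈ (edgeFinset P v).erase e, m v f / m v e =
      3 / 2 * ∑ v ∈ V, (((n : ℝ) - 2 * (hD.down ξ v).card) ^ 2 - n) := by
    have h1 := LatticeGraph.sum_ratio_eq_sum_sign (Γ := hD.graph) ξ (by
      intro v hv e he
      have hv' := hD.mem_vertexFinset.1 hv
      exact hξ v hv' e ((hD.mem_edgeFinset hv').1 he))
    have h2 : ∑ v ∈ V, ∑ e ∈ edgeFinset P v, ∑ f ∈ (edgeFinset P v).erase e,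
        ((ξ ⬝ᵥ hD.edgeVec v f : ℤ) : ℚ) / (ξ ⬝ᵥ hD.edgeVec v e : ℤ) =
        3 / 2 * ∑ v ∈ V, (((n : ℚ) - 2 * (hD.down ξ v).card) ^ 2 - n) := by
      refine h1.trans ?_
      congr 1
      refine Finset.sum_congr rfl fun v hv => ?_
      exact hD.sum_sign_pairs hξ (hD.mem_vertexFinset.1 hv)
    have h3 := congrArg (Rat.cast (K := ℝ)) h2
    push_cast at h3
    exact h3
  have htotal : ∑ e ∈ (hD.finite_faces 1).toFinset, relLength e =
      ∑ v ∈ V, (n : ℝ) + 3 / 2 * ∑ v ∈ V, (((n : ℝ) - 2 * (hD.down ξ v).card) ^ 2 - n) := by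
    have h1 := hD.sum_vertex_edge relLength
    rw [Finset.sum_congr rfl fun v hv => Finset.sum_congr rfl (hlen v hv)] at h1
    simp only [Finset.sum_sub_distrib] at h1
    rw [hflag] at h1
    simp only [Finset.sum_neg_distrib] at h1
    have h2 : -∑ v ∈ V, ∑ e ∈ edgeFinset P v, toReal ξ ⬝ᵥ v / m v e =
        ∑ v ∈ V, (n : ℝ) + ∑ v ∈ V, ∑ e ∈ edgeFinset P v,
          ∑ f ∈ (edgeFinset P v).erase e, m v f / m v e := by
      rw [← Finset.sum_neg_distrib, ← Finset.sum_add_distrib]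
      refine Finset.sum_congr rfl fun v hv => ?_
      rw [← Finset.sum_neg_distrib, Finset.sum_congr rfl (hvert v hv), Finset.sum_add_distrib,
        Finset.sum_const, hD.card_edgeFinset (hD.mem_vertexFinset.1 hv)]
      simp
    rw [← hratio]
    linarith
  have hf1 : (fVec P 1 : ℝ) = ∑ v ∈ V, ((hD.down ξ v).card : ℝ) := by
    rw [hD.fVec_eq_sum hξ]
    simp
    rfl
  -- Double counting of flags: n edges at each vertex, two vertices on each edge.
  have hf1' : 2 * (fVec P 1 : ℝ) = ∑ v ∈ V, (n : ℝ) := by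
    have h1 := hD.sum_vertex_edge fun _ => 1
    rw [Finset.sum_const, ← Set.ncard_eq_toFinset_card _ (hD.finite_faces 1)] at h1
    rw [fVec]
    simp only [nsmul_eq_mul, mul_one] at h1
    rw [← h1]
    refine Finset.sum_congr rfl fun v hv => ?_
    rw [Finset.sum_const, hD.card_edgeFinset (hD.mem_vertexFinset.1 hv)]
    simp
  have hf2 : 2 * (fVec P 2 : ℝ) =
      ∑ v ∈ V, ((hD.down ξ v).card : ℝ) * ((hD.down ξ v).card - 1) := by
    rw [hD.fVec_eq_sum hξ]
    push_cast
    rw [Finset.mul_sum]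
    refine Finset.sum_congr rfl fun v _ => ?_
    rw [Nat.cast_choose_two]
    ring
  have hexp : ∑ v ∈ V, (((n : ℝ) - 2 * (hD.down ξ v).card) ^ 2 - n) =
      (n - 1) * ∑ v ∈ V, (n : ℝ) - 4 * (n - 1) * ∑ v ∈ V, ((hD.down ξ v).card : ℝ)
      + 4 * ∑ v ∈ V, ((hD.down ξ v).card : ℝ) * ((hD.down ξ v).card - 1) := by
    rw [Finset.mul_sum, Finset.mul_sum, Finset.mul_sum, ← Finset.sum_sub_distrib,
      ← Finset.sum_add_distrib]
    refine Finset.sum_congr rfl fun v _ => ?_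
    ring
  rw [htotal, hexp, ← hf1, ← hf2, ← hf1']
  ring

end IsDelzant
end DelzantReflexive

/-! ### The h-vector, its symmetry, and the two forms of C. -/

namespace DelzantReflexive

/-- Inversion of the binomial transform. -/
lemma alternating_sum_choose_mul_choose {n j a : ℕ} (hj : j ≤ n) (ha : a ≤ n) :
    ∑ i ∈ Finset.range (j + 1), (-1 : ℤ) ^ (j - i) * ((n - i).choose (n - j) : ℤ) *
      (a.choose (n - i) : ℤ) = if a = n - j then 1 else 0 := by
  obtain ⟨q, rfl⟩ := Nat.exists_eq_add_of_le hj
  rw [Nat.add_sub_cancel_left, ← Finset.sum_range_reflect]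
  -- With q = n - j, C(a, q+t) C(q+t, q) = C(a, q) C(a-q, t), so an alternating row sum remains. It
  -- is 1 also when a < q, where a - q truncates to 0, but then C(a, q) = 0.
  have h1 : ∀ t ∈ Finset.range (j + 1), (-1 : ℤ) ^ (j - (j + 1 - 1 - t)) *
      ((j + q - (j + 1 - 1 - t)).choose q : ℤ) * (a.choose (j + q - (j + 1 - 1 - t)) : ℤ) =
      a.choose q * ((-1) ^ t * ((a - q).choose t : ℤ)) := by
    intro t ht
    have ht := Finset.mem_range.1 ht
    have e1 : j - (j + 1 - 1 - t) = t := by omega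
    have e2 : j + q - (j + 1 - 1 - t) = q + t := by omega
    rw [e1, e2]
    by_cases hle : q + t ≤ a
    · have h2 := Nat.choose_mul (n := a) (Nat.le_add_right q t)
      rw [Nat.add_sub_cancel_left] at h2
      have h3 : (a.choose (q + t) : ℤ) * (q + t).choose q = a.choose q * (a - q).choose t := by
        exact_mod_cast h2
      linear_combination (-1 : ℤ) ^ t * h3
    · rw [Nat.choose_eq_zero_of_lt (by omega : a < q + t)]
      rcases Nat.lt_or_ge a q with h | h
      · rw [Nat.choose_eq_zero_of_lt h]
        simp
      · rw [Nat.choose_eq_zero_of_lt (by omega : a - q < t)]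
        simp
  rw [Finset.sum_congr rfl h1, ← Finset.mul_sum]
  have h2 : ∑ t ∈ Finset.range (j + 1), (-1 : ℤ) ^ t * ((a - q).choose t : ℤ) =
      if a - q = 0 then 1 else 0 := by
    rw [← Int.alternating_sum_range_choose]
    refine (Finset.sum_subset (Finset.range_mono (by omega)) fun t _ ht => ?_).symm
    rw [Finset.mem_range, not_lt] at ht
    rw [Nat.choose_eq_zero_of_lt (by omega)]
    simp
  rw [h2]
  rcases lt_trichotomy a q with h | rfl | h
  · rw [Nat.choose_eq_zero_of_lt h, if_neg h.ne]
    simp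
  · simp
  · rw [if_neg (by omega), if_neg h.ne', mul_zero]

lemma sum_Icc_one_eq_sum_range (g : ℕ → ℤ) (m : ℕ) :
    ∑ k ∈ Finset.Icc 1 m, g k = ∑ x ∈ Finset.range m, g (x + 1) := by
  induction m with
  | zero => simp
  | succ m ih => rw [Finset.sum_Icc_succ_top (by omega), ih, Finset.sum_range_succ]

/-- `C(k₀, n, h)` is a symmetrized quadratic moment of a palindromic vector `h`. -/
lemma Ch_eq_sum (k₀ n : ℕ) (h : ℕ → ℤ) (hh : ∀ p ≤ n, h p = h (n - p)) :
    Ch k₀ n h = ∑ p ∈ Finset.range (n + 1),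
      (6 * (p : ℤ) * (p - 1) + (5 - 3 * n - k₀) * p) * h p := by
  rw [Ch]
  obtain ⟨m, rfl | rfl⟩ := Nat.even_or_odd' n
  · rw [if_pos (by omega), Nat.mul_div_cancel_left m two_pos, ChEven, sum_Icc_one_eq_sum_range]
    -- The terms p = m - k and p = m + k share the same h, and their coefficients add up to 12k² -
    -- 2m(k₀ + 1); p = m stays alone.
    have e : 2 * m + 1 = m + 1 + m := by ring
    rw [e, Finset.sum_range_add, Finset.sum_range_succ, ← Finset.sum_range_reflect
      (fun p : ℕ => (6 * (p : ℤ) * (p - 1) + (5 - 3 * ((2 * m : ℕ) : ℤ) - k₀) * p) * h p) m,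
      add_right_comm, ← Finset.sum_add_distrib, sub_eq_add_neg]
    congr 1
    · refine Finset.sum_congr rfl fun x hx => ?_
      have hx := Finset.mem_range.1 hx
      have h1 := hh (m + 1 + x) (by omega)
      have e2 : 2 * m - (m + 1 + x) = m - (x + 1) := by omega
      have e3 : m - 1 - x = m - (x + 1) := by omega
      rw [h1, e2, e3]
      push_cast [Nat.cast_sub (by omega : x + 1 ≤ m)]
      ring
    · push_cast
      ring
  · rw [if_neg (by omega), (by omega : (2 * m + 1) / 2 = m), ChOdd, sum_Icc_one_eq_sum_range]
    -- Here the middle consists of the pair p = m, m + 1, which gives the separate h_m term; the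
    -- others pair as m - k and m + 1 + k.
    have e : 2 * m + 1 + 1 = m + 1 + (1 + m) := by ring
    rw [e, Finset.sum_range_add, Finset.sum_range_succ, Finset.sum_range_add,
      ← Finset.sum_range_reflect
      (fun p : ℕ => (6 * (p : ℤ) * (p - 1) + (5 - 3 * ((2 * m + 1 : ℕ) : ℤ) - k₀) * p) * h p) m,
      Finset.sum_range_one]
    have h0 : h (m + 1 + 0) = h m := by
      rw [hh (m + 1 + 0) (by omega)]
      congr 1
      omega
    have h1 : ∀ x ∈ Finset.range m,
        (12 * ((x + 1 : ℕ) : ℤ) * (((x + 1 : ℕ) : ℤ) + 1) + 3 - (2 * (m : ℤ) + 1) * ((k₀ : ℤ) + 1))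
          * h (m - (x + 1)) =
        (6 * ((m - 1 - x : ℕ) : ℤ) * (((m - 1 - x : ℕ) : ℤ) - 1) +
          (5 - 3 * ((2 * m + 1 : ℕ) : ℤ) - k₀) * ((m - 1 - x : ℕ) : ℤ)) * h (m - 1 - x) +
        (6 * ((m + 1 + (1 + x) : ℕ) : ℤ) * (((m + 1 + (1 + x) : ℕ) : ℤ) - 1) +
          (5 - 3 * ((2 * m + 1 : ℕ) : ℤ) - k₀) * ((m + 1 + (1 + x) : ℕ) : ℤ))
          * h (m + 1 + (1 + x)) := by
      intro x hx
      have hx := Finset.mem_range.1 hx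
      have h1 := hh (m + 1 + (1 + x)) (by omega)
      have e2 : 2 * m + 1 - (m + 1 + (1 + x)) = m - (x + 1) := by omega
      have e3 : m - 1 - x = m - (x + 1) := by omega
      rw [h1, e2, e3]
      push_cast [Nat.cast_sub (by omega : x + 1 ≤ m)]
      ring
    rw [Finset.sum_congr rfl h1, Finset.sum_add_distrib, h0]
    push_cast
    ring

namespace IsDelzant

variable {n : ℕ} {P : Set (Fin n → ℝ)}

lemma card_down_le (hD : IsDelzant P) (ξ : Fin n → ℤ) {v : Fin n → ℝ} (hv : v ∈ vertices P) :
    (hD.down ξ v).card ≤ n := by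
  exact (Finset.card_le_card (hD.down_subset ξ v)).trans (hD.card_edgeFinset hv).le

lemma IsGeneric.neg {hD : IsDelzant P} {ξ : Fin n → ℤ} (hξ : hD.IsGeneric ξ) :
    hD.IsGeneric (-ξ) := by
  intro v hv e he
  rw [neg_dotProduct]
  exact neg_ne_zero.2 (hξ v hv e he)

/-- The `h`-vector counts the vertices by their index. -/
lemma hVec_eq_sum (hD : IsDelzant P) {ξ : Fin n → ℤ} (hξ : hD.IsGeneric ξ) {j : ℕ} (hj : j ≤ n) :
    hVec P j = ∑ v ∈ hD.vertexFinset, if (hD.down ξ v).card = n - j then 1 else 0 := by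
  rw [hVec]
  simp only [hD.fVec_eq_sum hξ, Nat.cast_sum, Finset.mul_sum]
  rw [Finset.sum_comm]
  exact Finset.sum_congr rfl fun v hv =>
    alternating_sum_choose_mul_choose hj (hD.card_down_le ξ (hD.mem_vertexFinset.1 hv))

/-- Passing to -ξ exchanges descending and ascending edges, replacing d(v) by n - d(v). -/
lemma hVec_eq_sum' (hD : IsDelzant P) {ξ : Fin n → ℤ} (hξ : hD.IsGeneric ξ) {j : ℕ} (hj : j ≤ n) :
    hVec P j = ∑ v ∈ hD.vertexFinset, if (hD.down ξ v).card = j then 1 else 0 := by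
  rw [hD.hVec_eq_sum hξ.neg hj]
  refine Finset.sum_congr rfl fun v hv => ?_
  have h1 := hD.card_down_neg hξ (hD.mem_vertexFinset.1 hv)
  refine if_congr ?_ rfl rfl
  omega

/-- The Dehn–Sommerville equations. -/
lemma hVec_symm (hD : IsDelzant P) {j : ℕ} (hj : j ≤ n) : hVec P j = hVec P (n - j) := by
  obtain ⟨ξ, hξ⟩ := hD.exists_isGeneric
  rw [hD.hVec_eq_sum hξ hj, hD.hVec_eq_sum' hξ (Nat.sub_le n j)]

/-- Both sides are the sum over vertices of 6d(d - 1) + (5 - 3n - k₀)d, with d the number of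
descending edges. -/
lemma Cf_eq_Ch (hD : IsDelzant P) (k₀ : ℕ) : Cf k₀ n (fVec P) = Ch k₀ n (hVec P) := by
  obtain ⟨ξ, hξ⟩ := hD.exists_isGeneric
  rw [Ch_eq_sum k₀ n (hVec P) fun p hp => hD.hVec_symm hp]
  have h1 : ∀ p ∈ Finset.range (n + 1),
      (6 * (p : ℤ) * (p - 1) + (5 - 3 * n - k₀) * p) * hVec P p =
      ∑ v ∈ hD.vertexFinset, if (hD.down ξ v).card = p then
        (6 * (p : ℤ) * (p - 1) + (5 - 3 * n - k₀) * p) else 0 := by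
    intro p hp
    rw [hD.hVec_eq_sum' hξ (Nat.lt_succ_iff.1 (Finset.mem_range.1 hp)), Finset.mul_sum]
    exact Finset.sum_congr rfl fun v _ => by rw [mul_ite, mul_one, mul_zero]
  rw [Finset.sum_congr rfl h1, Finset.sum_comm, Cf, hD.fVec_eq_sum hξ, hD.fVec_eq_sum hξ]
  push_cast
  rw [Finset.mul_sum, Finset.mul_sum, ← Finset.sum_add_distrib]
  refine Finset.sum_congr rfl fun v hv => ?_
  rw [Finset.sum_ite_eq, if_pos (Finset.mem_range.2 (Nat.lt_succ_iff.2
    (hD.card_down_le ξ (hD.mem_vertexFinset.1 hv)))), Nat.choose_one_right]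
  have h2 : 2 * ((hD.down ξ v).card.choose 2 : ℚ) =
      (hD.down ξ v).card * ((hD.down ξ v).card - 1) := by
    rw [Nat.cast_choose_two]
    ring
  have h3 : 2 * ((hD.down ξ v).card.choose 2 : ℤ) =
      (hD.down ξ v).card * ((hD.down ξ v).card - 1) := by exact_mod_cast h2
  linear_combination 6 * h3

lemma Cf_eq_sum (hD : IsDelzant P) (hR : IsReflexive P) (k₀ : ℕ) :
    (Cf k₀ n (fVec P) : ℝ) =
      ∑ e ∈ (hD.finite_faces 1).toFinset, (relLength e - (k₀ : ℝ)) := by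
  rw [Finset.sum_sub_distrib, hD.sum_relLength hR, Finset.sum_const,
    ← Set.ncard_eq_toFinset_card _ (hD.finite_faces 1), Cf]
  simp only [fVec, nsmul_eq_mul]
  push_cast
  ring

lemma exists_relLength_eq_natCast' (hD : IsDelzant P) (hI : IsIntegral P)
    {e : Set (Fin n → ℝ)} (he : e ∈ faces P 1) : ∃ q : ℕ, 0 < q ∧ relLength e = q := by
  obtain ⟨v, hv, hve, -⟩ := hD.exists_vertex_isMax he 0
  exact hD.exists_relLength_eq_natCast hI hv ⟨he, hve⟩

/-- If there are edges, their relative lengths are positive multiples of the positive index. -/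
lemma index_spec (hD : IsDelzant P) (hI : IsIntegral P) (hne : (faces P 1).Nonempty) :
    0 < index P ∧ ∀ e ∈ faces P 1, ∃ q : ℕ, 0 < q ∧ relLength e = (index P : ℝ) * (q : ℝ) := by
  have hmem : index P ∈ {k : ℕ | ∀ e ∈ faces P 1, ∃ q : ℕ, relLength e = (k : ℝ) * (q : ℝ)} := by
    -- The supremum is attained because the set contains 1 and is bounded by the length of any one
    -- edge.
    refine Nat.sSup_mem ⟨1, fun e he => ?_⟩ ?_
    · obtain ⟨q, -, hq⟩ := hD.exists_relLength_eq_natCast' hI he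
      exact ⟨q, by rw [hq, Nat.cast_one, one_mul]⟩
    · obtain ⟨e, he⟩ := hne
      obtain ⟨L, hL, hLe⟩ := hD.exists_relLength_eq_natCast' hI he
      refine ⟨L, fun k hk => ?_⟩
      obtain ⟨q, hq⟩ := hk e he
      rw [hLe] at hq
      have h1 : L = k * q := by exact_mod_cast hq
      exact Nat.le_of_dvd hL ⟨q, h1⟩
  have hpos : ∀ e ∈ faces P 1, ∃ q : ℕ, 0 < index P * q ∧
      relLength e = (index P : ℝ) * (q : ℝ) := by
    intro e he
    obtain ⟨q, hq⟩ := hmem e he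
    obtain ⟨L, hL, hLe⟩ := hD.exists_relLength_eq_natCast' hI he
    refine ⟨q, ?_, hq⟩
    have h1 : L = index P * q := by
      rw [hLe] at hq
      exact_mod_cast hq
    omega
  constructor
  · obtain ⟨e, he⟩ := hne
    obtain ⟨q, hq, -⟩ := hpos e he
    exact Nat.pos_of_mul_pos_right hq
  · intro e he
    obtain ⟨q, hq, h⟩ := hpos e he
    exact ⟨q, Nat.pos_of_mul_pos_left hq, h⟩

end IsDelzant

end DelzantReflexive

theorem corollary5p9 (n : ℕ) (P : Set (Fin n → ℝ))
    (hD : DelzantReflexive.IsDelzant P) (hR : DelzantReflexive.IsReflexive P) :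
    DelzantReflexive.Cf (DelzantReflexive.index P) n (DelzantReflexive.fVec P)
        = DelzantReflexive.Ch (DelzantReflexive.index P) n (DelzantReflexive.hVec P) ∧
    (∃ q : ℕ, DelzantReflexive.Cf (DelzantReflexive.index P) n (DelzantReflexive.fVec P)
        = (q : ℤ) * (DelzantReflexive.index P : ℤ)) ∧
    (DelzantReflexive.Cf (DelzantReflexive.index P) n (DelzantReflexive.fVec P) = 0 ↔
      ∀ e ∈ DelzantReflexive.faces P 1,
        DelzantReflexive.relLength e = (DelzantReflexive.index P : ℝ)) := by
  refine ⟨hD.Cf_eq_Ch _, ?_⟩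
  have hsum := hD.Cf_eq_sum hR (DelzantReflexive.index P)
  rcases (DelzantReflexive.faces P 1).eq_empty_or_nonempty with hempty | hne
  -- Without edges the sum of l(e) - k₀ is empty, whatever the index is.
  · have h0 : DelzantReflexive.Cf (DelzantReflexive.index P) n (DelzantReflexive.fVec P) = 0 := by
      rw [Finset.sum_eq_zero] at hsum
      · exact_mod_cast hsum
      · intro e he
        rw [Set.Finite.mem_toFinset, hempty] at he
        exact absurd he (Set.notMem_empty e)
    refine ⟨⟨0, by rw [h0]; simp⟩, fun _ e he => ?_, fun _ => h0⟩
    rw [hempty] at he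
    exact absurd he (Set.notMem_empty e)
  · obtain ⟨hpos, hlen⟩ := hD.index_spec hR.integral hne
    choose! q hq hqe using hlen
    -- The natural subtraction is exact since each quotient q e is positive.
    have hterm : ∀ e ∈ (hD.finite_faces 1).toFinset,
        DelzantReflexive.relLength e - (DelzantReflexive.index P : ℝ) =
          ((q e - 1 : ℕ) : ℝ) * (DelzantReflexive.index P : ℝ) := by
      intro e he
      rw [Set.Finite.mem_toFinset] at he
      rw [hqe e he, Nat.cast_sub (hq e he)]
      push_cast
      ring
    have hval : DelzantReflexive.Cf (DelzantReflexive.index P) n (DelzantReflexive.fVec P) =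
        ((∑ e ∈ (hD.finite_faces 1).toFinset, (q e - 1) : ℕ) : ℤ) *
          (DelzantReflexive.index P : ℤ) := by
      rw [Finset.sum_congr rfl hterm, ← Finset.sum_mul] at hsum
      exact_mod_cast hsum
    refine ⟨⟨_, hval⟩, ?_⟩
    have hnn : ∀ e ∈ (hD.finite_faces 1).toFinset,
        0 ≤ DelzantReflexive.relLength e - (DelzantReflexive.index P : ℝ) := by
      intro e he
      rw [hterm e he]
      positivity
    rw [← Int.cast_eq_zero (α := ℝ), hsum, Finset.sum_eq_zero_iff_of_nonneg hnn]
    simp only [Set.Finite.mem_toFinset, sub_eq_zero]
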